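/- Let $\hat{\mathcal L}:\mathbb R^{m\times n}\to\mathbb R$, $\hat{\mathcal L}(X)=\frac1N\sum_{i=1}^N\ell(f(W_0+X;x_i),y_i)$, be the empirical risk of full fine-tuning of one weight matrix $W_0\in\mathbb R^{m\times n}$ of a network $f$ with loss $\ell$ on data $(x_i,y_i)_{i=1}^N$, and assume that $\hat{\mathcal L}$ is twice differentiable. Let $\lambda\ge 0$ and put $$\hat{\mathcal L}^{\mathrm{full}}_\lambda(X)=\hat{\mathcal L}(X)+\lambda\|X\|_*,\qquad \hat{\mathcal L}^{\mathrm{lora}}_\lambda(A,B)=\hat{\mathcal L}(AB^\top)+\tfrac{\lambda}{2}\big(\|A\|_F^2+\|B\|_F^2\big),$$ for $A\in\mathbb R^{m\times r}$, $B\in\mathbb R^{n\times r}$, where $\|\cdot\|_*$ is the nuclear norm. Assume that $\hat{\mathcal L}^{\mathrm{full}}_\lambda$ has a global minimizer $X_\star$ of rank $r_\star\ge 1$, and let $r>r_\star$. Let $D\in\mathbb R$. Let $\alpha$ be the $(r,D)$-RSC constant of $\hat{\mathcal L}$ about $X_\star$, that is, the largest real $\alpha$ with $\langle\nabla\hat{\mathcal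 L}(X)-\nabla\hat{\mathcal L}(X_\star),X-X_\star\rangle\ge\alpha\|X-X_\star\|_F^2$ for all $X$ with $\|X-X_\star\|_F\le D$ and $\operatorname{rank}X\le r$. Let $\beta$ be the $(r,D)$-RSM constant of $\hat{\mathcal L}$ about $X_\star$, that is, the smallest real $\beta$ with $\nabla^2\hat{\mathcal L}(X)[UX+XV,UX+XV]\le\beta\|UX+XV\|_F^2$ for all such $X$ and all $U\in\mathbb R^{m\times m}$, $V\in\mathbb R^{n\times n}$ of rank $1$ with $\|U\|_F=\|V\|_F=1$. Assume that both constants exist (as real numbers) and that $\alpha>0$. Let $(A,B)$ be a second-order stationary point of $\hat{\mathcal L}^{\mathrm{lora}}_\lambda$, that is, its gradient vanishes at $(A,B)$ and its Hessian there is positive semidefinite. Let $X=AB^\top$ and suppose $\|X-X_\star\|_F\le D$. Let $\sigma_1\ge\sigma_2\ge\cdots$ be the singular values of $X$, continued by $0$. Then: (i) if $\sigma_r\le\frac{2\alpha}{\beta}\sigma_{r_\star}$, then $X$ is a global minimizer of $\hat{\mathcal L}^{\mathrm{full}}_\lambda$; (ii) if $\sigma_r>\frac{2\alpha}{\beta}\sigma_{r_\star}$,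 then $X$ is spurious, i.e. not a global minimizer of $\hat{\mathcal L}^{\mathrm{full}}_\lambda$, and $$\|X\|_F\ \ge\ \sqrt{\frac{\sum_{s=r_\star+1}^{r}\sigma_s^2}{1-\frac{2\alpha\,\sigma_{r_\star}}{\beta\,\sigma_r}}}\;-\;\|X_\star\|_F .$$ -/

import Mathlib

open scoped Matrix

attribute [local instance] Matrix.frobeniusNormedAddCommGroup Matrix.frobeniusNormedSpace

namespace LoRA

noncomputable section

/-- The `s`-th largest singular value `σ_s(X)`, with the index `s` starting at `1`
(so `σ_s(X) = 0` once `s` exceeds the rank of `X`). It is only used with `s ≥ 1`. -/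
def sigma {m n : ℕ} (X : Matrix (Fin m) (Fin n) ℝ) (s : ℕ) : ℝ :=
  (Matrix.toEuclideanLin X).singularValues (s - 1)

/-- The nuclear norm: the sum of all singular values. -/
def nuclearNorm {m n : ℕ} (X : Matrix (Fin m) (Fin n) ℝ) : ℝ :=
  ∑ s ∈ Finset.Icc 1 (min m n), sigma X s

/-- The derivative of `f` at `x` in the direction `u`, that is, `⟨∇f(x), u⟩`. -/
def dirDeriv {E : Type*} [NormedAddCommGroup E] [NormedSpace ℝ E] (f : E → ℝ) (x u : E) : ℝ :=
  fderiv ℝ f x u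

/-- The second derivative of `f` at `x`, as a quadratic form. -/
def hess {E : Type*} [NormedAddCommGroup E] [NormedSpace ℝ E] (f : E → ℝ) (x u : E) : ℝ :=
  fderiv ℝ (fderiv ℝ f) x u u

/-- `f` is twice (Fréchet) differentiable everywhere. -/
def TwiceDifferentiable {E : Type*} [NormedAddCommGroup E] [NormedSpace ℝ E] (f : E → ℝ) : Prop :=
  Differentiable ℝ f ∧ Differentiable ℝ (fderiv ℝ f)

/-- Second-order stationary points of a twice differentiable function. -/
def IsSOSP {E : Type*} [NormedAddCommGroup E] [NormedSpace ℝ E] (L : E → ℝ) (x : E) : Prop :=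
  (∀ u : E, dirDeriv L x u = 0) ∧ ∀ u : E, 0 ≤ hess L x u

/-- `x` is a global minimizer of `L`. -/
def IsGlobalMin {E : Type*} (L : E → ℝ) (x : E) : Prop :=
  ∀ y : E, L x ≤ L y

/-- The empirical risk of full fine-tuning, as a function of the change `X` of the weight matrix
`W₀`: the mean of `ℓ (net (W₀ + X) xᵢ) yᵢ` over the `N` samples. -/
def fullRisk {m n K N : ℕ} {𝓧 𝓨 : Type*}
    (net : Matrix (Fin m) (Fin n) ℝ → 𝓧 → (Fin K → ℝ)) (ℓ : (Fin K → ℝ) → 𝓨 → ℝ)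
    (W₀ : Matrix (Fin m) (Fin n) ℝ) (data : Fin N → 𝓧 × 𝓨)
    (X : Matrix (Fin m) (Fin n) ℝ) : ℝ :=
  (1 / (N : ℝ)) * ∑ i, ℓ (net (W₀ + X) (data i).1) (data i).2

/-- The nuclear-norm regularized full fine-tuning loss `f(X) + lam ‖X‖_*`. -/
def fullLoss {m n : ℕ} (f : Matrix (Fin m) (Fin n) ℝ → ℝ) (lam : ℝ)
    (X : Matrix (Fin m) (Fin n) ℝ) : ℝ :=
  f X + lam * nuclearNorm X

/-- The rank-`r` LoRA loss with weight decay,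
`(A, B) ↦ f(A Bᵀ) + (lam / 2) (‖A‖_F² + ‖B‖_F²)`. -/
def loraLoss {m n r : ℕ} (f : Matrix (Fin m) (Fin n) ℝ → ℝ) (lam : ℝ)
    (p : Matrix (Fin m) (Fin r) ℝ × Matrix (Fin n) (Fin r) ℝ) : ℝ :=
  f (p.1 * p.2ᵀ) + lam / 2 * (‖p.1‖ ^ 2 + ‖p.2‖ ^ 2)

/-- `f` is `(a, r, D)`-restricted strongly convex about `Xs`. The right-hand side
is `⟨∇f(X) - ∇f(Xs), X - Xs⟩`. -/
def RestrictedStronglyConvex {m n : ℕ} (f : Matrix (Fin m) (Fin n) ℝ → ℝ)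
    (r : ℕ) (D : ℝ) (Xs : Matrix (Fin m) (Fin n) ℝ) (a : ℝ) : Prop :=
  ∀ X : Matrix (Fin m) (Fin n) ℝ, ‖X - Xs‖ ≤ D → X.rank ≤ r →
    a * ‖X - Xs‖ ^ 2 ≤ dirDeriv f X (X - Xs) - dirDeriv f Xs (X - Xs)

/-- `f` is `(b, r, D)`-restricted smooth about `Xs`. -/
def RestrictedSmooth {m n : ℕ} (f : Matrix (Fin m) (Fin n) ℝ → ℝ)
    (r : ℕ) (D : ℝ) (Xs : Matrix (Fin m) (Fin n) ℝ) (b : ℝ) : Prop :=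
  ∀ X : Matrix (Fin m) (Fin n) ℝ, ‖X - Xs‖ ≤ D → X.rank ≤ r →
    ∀ (U : Matrix (Fin m) (Fin m) ℝ) (V : Matrix (Fin n) (Fin n) ℝ),
      U.rank = 1 → ‖U‖ = 1 → V.rank = 1 → ‖V‖ = 1 →
        hess f X (U * X + X * V) ≤ b * ‖U * X + X * V‖ ^ 2

/-- `a` is the `(r, D)`-RSC constant of `f` about `Xs`: the largest admissible constant. -/
def IsRSCConstant {m n : ℕ} (f : Matrix (Fin m) (Fin n) ℝ → ℝ)
    (r : ℕ) (D : ℝ) (Xs : Matrix (Fin m) (Fin n) ℝ) (a : ℝ) : Prop :=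
  IsGreatest {a' : ℝ | RestrictedStronglyConvex f r D Xs a'} a

/-- The `(r, D)`-RSM constant of `f` about `Xs` is finite and equal to `b`: the smallest
admissible constant. -/
def IsRSMConstant {m n : ℕ} (f : Matrix (Fin m) (Fin n) ℝ → ℝ)
    (r : ℕ) (D : ℝ) (Xs : Matrix (Fin m) (Fin n) ℝ) (b : ℝ) : Prop :=
  IsLeast {b' : ℝ | RestrictedSmooth f r D Xs b'} b

end

end LoRA

namespace LoRA

open Matrix Finset

/-! Write `X = A * Bᵀ` and `G = ∇f(X)`. Stationarity says `G * B = -lam A` and `Gᵀ * A = -lam B`.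
For `lam > 0` this forces `Aᵀ * A = Bᵀ * B`, and for every `lam ≥ 0` each singular pair of `X`
satisfies `G q = -lam p`, `Gᵀ p = -lam q` (`grad_mulVec_singular`), so `⟨G, X⟩ = -lam ‖X‖_*`.
Together with the optimality conditions at `Xs`, restricted strong convexity becomes `α ‖X - Xs‖² ≤
⟨-G, Xs⟩ - lam ‖Xs‖_*` (`mul_norm_sub_sq_le`). Hence `X = Xs` as soon as `G` has operator norm at
most `lam` (`eq_of_opBound`).

If `rank X < r`, second-order stationarity along a kernel vector of the factors gives that operator
bound. If `rank X = r`, moving mass off the smallest singular pair only gives `-⟨u, G v⟩ ≤ lam + β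
σ_r` (`IsSOSP.neg_grad_le`). Then `-G = Z + β σ_r W`, where `Z` has operator norm at most `lam` and
`W` is a contraction orthogonal to the singular vectors of `X`, and with `ν = ⟨W, Xs⟩` one gets `α
‖X - Xs‖² ≤ β σ_r ν`. An Eckart–Young argument for `X + σ_{rs} W` against the rank-`rs` matrix `Xs`
gives `2 σ_{rs} ν + ∑_{s > rs} σ_s² ≤ ‖X - Xs‖²` (`frob_add_tail_le`). The two inequalities
contradict each other when `β σ_r ≤ 2 α σ_{rs}`; otherwise, eliminating `ν` bounds `‖X - Xs‖` from
below. -/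

/-- The Frobenius inner product. -/
def frob {m n : ℕ} (X Y : Matrix (Fin m) (Fin n) ℝ) : ℝ := ∑ i, X i ⬝ᵥ Y i

/-- A family of vectors is orthonormal for the dot product. -/
def Ortho {k n : ℕ} (p : Fin k → Fin n → ℝ) : Prop :=
  ∀ i j, p i ⬝ᵥ p j = if i = j then 1 else 0

/-- The operator norm of `W` is at most `c`, stated without square roots. -/
def OpBound {m n : ℕ} (W : Matrix (Fin m) (Fin n) ℝ) (c : ℝ) : Prop :=
  ∀ u v, 2 * (u ⬝ᵥ W *ᵥ v) ≤ c * (u ⬝ᵥ u + v ⬝ᵥ v)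

/-! ### Frobenius inner product -/

section frob

variable {m n : ℕ} (X Y Z : Matrix (Fin m) (Fin n) ℝ)

theorem norm_sq_eq_frob : ‖X‖ ^ 2 = frob X X := by
  rw [Matrix.frobenius_norm_def, ← Real.sqrt_eq_rpow, Real.sq_sqrt (by positivity)]
  simp [frob, dotProduct, sq]

theorem frob_comm : frob X Y = frob Y X := by
  simp [frob, dotProduct_comm]

theorem frob_add_left : frob (X + Y) Z = frob X Z + frob Y Z := by
  simp only [frob, ← sum_add_distrib]
  exact sum_congr rfl fun i _ => add_dotProduct (X i) (Y i) (Z i)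

theorem frob_smul_left (c : ℝ) : frob (c • X) Y = c * frob X Y := by
  simp only [frob, mul_sum]
  exact sum_congr rfl fun i _ => smul_dotProduct c (X i) (Y i)

theorem frob_add_right : frob X (Y + Z) = frob X Y + frob X Z := by
  rw [frob_comm, frob_add_left, frob_comm Y, frob_comm Z]

theorem frob_smul_right (c : ℝ) : frob X (c • Y) = c * frob X Y := by
  rw [frob_comm, frob_smul_left, frob_comm]

theorem frob_neg_left : frob (-X) Y = -frob X Y := by
  rw [← neg_one_smul ℝ X, frob_smul_left, neg_one_mul]

theorem frob_neg_right : frob X (-Y) = -frob X Y := by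
  rw [frob_comm, frob_neg_left, frob_comm]

theorem frob_sub_right : frob X (Y - Z) = frob X Y - frob X Z := by
  rw [sub_eq_add_neg, frob_add_right, frob_neg_right, sub_eq_add_neg]

theorem frob_sub_left : frob (X - Y) Z = frob X Z - frob Y Z := by
  rw [sub_eq_add_neg, frob_add_left, frob_neg_left, sub_eq_add_neg]

theorem frob_sum_right {ι : Type*} (s : Finset ι) (Y : ι → Matrix (Fin m) (Fin n) ℝ) :
    frob X (∑ i ∈ s, Y i) = ∑ i ∈ s, frob X (Y i) := by
  classical
  induction s using Finset.induction_on with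
  | empty => simp [frob, dotProduct]
  | insert a s ha ih => rw [sum_insert ha, sum_insert ha, frob_add_right, ih]

theorem frob_vecMulVec_right (u : Fin m → ℝ) (v : Fin n → ℝ) :
    frob X (vecMulVec u v) = u ⬝ᵥ X *ᵥ v := by
  simp only [frob, dotProduct, vecMulVec_apply, mulVec, mul_sum]
  exact sum_congr rfl fun i _ => sum_congr rfl fun j _ => by ring

theorem frob_vecMulVec_left (u : Fin m → ℝ) (v : Fin n → ℝ) :
    frob (vecMulVec u v) X = u ⬝ᵥ X *ᵥ v := by
  rw [frob_comm, frob_vecMulVec_right]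

theorem norm_sq_vecMulVec (u : Fin m → ℝ) (v : Fin n → ℝ) :
    ‖vecMulVec u v‖ ^ 2 = (u ⬝ᵥ u) * (v ⬝ᵥ v) := by
  rw [norm_sq_eq_frob, frob_vecMulVec_right, vecMulVec_mulVec]
  simp [mul_comm]

theorem frob_self_nonneg : 0 ≤ frob X X := by
  rw [← norm_sq_eq_frob]; positivity

/-- Every linear functional on matrices is the Frobenius pairing with a matrix. -/
theorem exists_frob_eq (φ : Matrix (Fin m) (Fin n) ℝ →ₗ[ℝ] ℝ) :
    ∃ G : Matrix (Fin m) (Fin n) ℝ, ∀ U, φ U = frob G U := by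
  refine ⟨Matrix.of fun i j => φ (Matrix.single i j 1), fun U => ?_⟩
  conv_lhs => rw [Matrix.matrix_eq_sum_single U]
  simp only [map_sum, frob, dotProduct, of_apply]
  refine sum_congr rfl fun i _ => sum_congr rfl fun j _ => ?_
  have : Matrix.single i j (U i j) = U i j • Matrix.single i j (1 : ℝ) := by
    simp
  rw [this, map_smul, smul_eq_mul, mul_comm]

end frob

/-! ### Orthonormal families and Bessel's inequality -/

section ortho

variable {k n : ℕ} {p : Fin k → Fin n → ℝ}

theorem dot_self_nonneg (u : Fin n → ℝ) : 0 ≤ u ⬝ᵥ u :=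
  sum_nonneg fun i _ => mul_self_nonneg (u i)

theorem Ortho.dot_sum (hp : Ortho p) (c : Fin k → ℝ) (i : Fin k) :
    p i ⬝ᵥ ∑ j, c j • p j = c i := by
  simp [dotProduct_sum, hp i]

theorem Ortho.sum_dot_sum (hp : Ortho p) (c d : Fin k → ℝ) :
    (∑ j, c j • p j) ⬝ᵥ ∑ j, d j • p j = ∑ j, c j * d j := by
  simp [sum_dotProduct, hp.dot_sum]

theorem Ortho.dot_residual (hp : Ortho p) (u : Fin n → ℝ) (i : Fin k) :
    p i ⬝ᵥ (u - ∑ j, (p j ⬝ᵥ u) • p j) = 0 := by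
  rw [dotProduct_sub, hp.dot_sum, sub_self]

theorem Ortho.residual_sq (hp : Ortho p) (u : Fin n → ℝ) :
    (u - ∑ i, (p i ⬝ᵥ u) • p i) ⬝ᵥ (u - ∑ i, (p i ⬝ᵥ u) • p i) =
      u ⬝ᵥ u - ∑ i, (p i ⬝ᵥ u) ^ 2 := by
  have h1 : u ⬝ᵥ ∑ i, (p i ⬝ᵥ u) • p i = ∑ i, (p i ⬝ᵥ u) ^ 2 := by
    rw [dotProduct_sum]
    exact sum_congr rfl fun i _ => by rw [dotProduct_smul, dotProduct_comm u, smul_eq_mul, sq]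
  rw [sub_dotProduct, dotProduct_sub, dotProduct_sub, dotProduct_comm (∑ i, _) u, h1, hp.sum_dot_sum]
  simp only [← sq]
  ring

theorem Ortho.bessel (hp : Ortho p) (u : Fin n → ℝ) :
    ∑ i, (p i ⬝ᵥ u) ^ 2 ≤ u ⬝ᵥ u := by
  have := hp.residual_sq u
  have := dot_self_nonneg (u - ∑ i, (p i ⬝ᵥ u) • p i)
  linarith

end ortho

/-! ### Singular values and the duality of nuclear and operator norm -/

section svd

variable {m n : ℕ}

theorem sigma_nonneg (X : Matrix (Fin m) (Fin n) ℝ) (s : ℕ) : 0 ≤ sigma X s :=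
  LinearMap.singularValues_nonneg _ _

theorem sigma_antitone (X : Matrix (Fin m) (Fin n) ℝ) : Antitone (sigma X) := fun _ _ h =>
  LinearMap.singularValues_antitone _ (Nat.sub_le_sub_right h 1)

theorem rank_eq_finrank_range_toEuclideanLin (X : Matrix (Fin m) (Fin n) ℝ) :
    X.rank = Module.finrank ℝ (Matrix.toEuclideanLin X).range := by
  rw [Matrix.toEuclideanLin_eq_toLin_orthonormal]
  exact Matrix.rank_eq_finrank_range_toLin _ _ _

theorem sigma_succ_pos_iff (X : Matrix (Fin m) (Fin n) ℝ) (i : ℕ) :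
    0 < sigma X (i + 1) ↔ i < X.rank := by
  rw [rank_eq_finrank_range_toEuclideanLin]
  exact LinearMap.singularValues_pos_iff_lt_finrank_range _

theorem sigma_succ_eq_zero (X : Matrix (Fin m) (Fin n) ℝ) {i : ℕ} (h : X.rank ≤ i) :
    sigma X (i + 1) = 0 :=
  le_antisymm (not_lt.1 fun h' => absurd ((sigma_succ_pos_iff X i).1 h') (not_lt.2 h))
    (sigma_nonneg _ _)

/-- The singular value decomposition. -/
theorem exists_svd (X : Matrix (Fin m) (Fin n) ℝ) :
    ∃ (p : Fin X.rank → Fin m → ℝ) (q : Fin X.rank → Fin n → ℝ), Ortho p ∧ Ortho q ∧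
      X = ∑ i : Fin X.rank, sigma X (i + 1) • vecMulVec (p i) (q i) := by
  set T := Matrix.toEuclideanLin X with hT
  have hfin : Module.finrank ℝ (EuclideanSpace ℝ (Fin n)) = n := finrank_euclideanSpace_fin
  set b := T.isSymmetric_adjoint_comp_self.eigenvectorBasis hfin with hb
  have hrn : X.rank ≤ n := by simpa using X.rank_le_width
  have hsig : ∀ i : Fin n, sigma X (i + 1) = T.singularValues i := fun i => rfl
  have hTb : ∀ i j, inner ℝ (T (b i)) (T (b j)) = if i = j then sigma X (j + 1) ^ 2 else 0 := by
    intro i j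
    rw [← LinearMap.adjoint_inner_right]
    have := T.isSymmetric_adjoint_comp_self.apply_eigenvectorBasis hfin j
    rw [LinearMap.comp_apply] at this
    rw [this, inner_smul_right, hsig, T.sq_singularValues_fin hfin]
    have := orthonormal_iff_ite.1 b.orthonormal i j
    rw [← hb, this]
    simp
  let e : Fin X.rank → Fin n := Fin.castLE hrn
  have hpos : ∀ i : Fin X.rank, 0 < sigma X (i + 1) := fun i => (sigma_succ_pos_iff X i).2 i.2
  have hmul : ∀ v : EuclideanSpace ℝ (Fin n), (T v).ofLp = X *ᵥ v.ofLp := fun v => rfl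
  have hdot : ∀ {k : ℕ} (v w : EuclideanSpace ℝ (Fin k)), v.ofLp ⬝ᵥ w.ofLp = inner ℝ v w := by
    intro k v w
    simp [EuclideanSpace.inner_eq_star_dotProduct, dotProduct_comm]
  -- Right vectors are eigenvectors of `T* T`; left vectors are their normalized images.
  refine ⟨fun i => ((sigma X (i + 1))⁻¹ • T (b (e i))).ofLp, fun i => (b (e i)).ofLp, ?_, ?_, ?_⟩
  · intro i j
    rw [hdot, inner_smul_left, inner_smul_right, hTb]
    by_cases hij : i = j
    · subst hij
      have := (hpos i).ne'
      simp [e]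
      field_simp
    · simp [e, hij]
  · intro i j
    rw [hdot, orthonormal_iff_ite.1 b.orthonormal]
    simp [e]
  · have hzero : ∀ i : Fin n, X.rank ≤ i → T (b i) = 0 := by
      intro i hi
      have := hTb i i
      rw [sigma_succ_eq_zero X hi] at this
      simpa using this
    apply Matrix.toEuclideanLin.injective
    apply b.toBasis.ext
    intro j
    rw [OrthonormalBasis.coe_toBasis, map_sum, LinearMap.sum_apply]
    have key : ∀ i : Fin X.rank, (Matrix.toEuclideanLin (sigma X (i + 1) •
        vecMulVec ((sigma X (i + 1))⁻¹ • T (b (e i))).ofLp (b (e i)).ofLp)) (b j) =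
        if e i = j then T (b j) else 0 := by
      intro i
      ext l
      rw [Matrix.ofLp_toLpLin, Matrix.toLin'_apply, smul_mulVec, vecMulVec_mulVec, hdot,
        orthonormal_iff_ite.1 b.orthonormal]
      have := (hpos i).ne'
      by_cases h : e i = j
      · subst h
        simp
        field_simp
      · simp [h]
    rw [sum_congr rfl fun i _ => key i]
    by_cases hj : (j : ℕ) < X.rank
    · have : ∀ i, (e i = j) ↔ i = ⟨j, hj⟩ := fun i => by
        simp [e, Fin.ext_iff]
      simp [this, hT]
    · rw [sum_eq_zero, ← hT, hzero j (not_lt.1 hj)]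
      intro i _
      rw [if_neg]
      rintro rfl
      exact hj i.2

theorem nuclearNorm_eq_sum (X : Matrix (Fin m) (Fin n) ℝ) :
    nuclearNorm X = ∑ i : Fin X.rank, sigma X (i + 1) := by
  have h : X.rank ≤ min m n := by
    simpa using And.intro X.rank_le_height X.rank_le_width
  rw [Fin.sum_univ_eq_sum_range (fun i => sigma X (i + 1)), nuclearNorm,
    ← Finset.Ico_add_one_right_eq_Icc, ← Finset.sum_Ico_add' (sigma X) 0 (min m n) 1,
    ← range_eq_Ico, ← Finset.sum_range_add_sum_Ico _ h, add_eq_left]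
  exact sum_eq_zero fun i hi => sigma_succ_eq_zero X (mem_Ico.1 hi).1

/-- The polar factor `∑ p_i q_iᵀ` attains the nuclear norm; Bessel makes it a contraction. -/
theorem exists_opBound_frob_eq_nuclearNorm (X : Matrix (Fin m) (Fin n) ℝ) :
    ∃ W, OpBound W 1 ∧ frob W X = nuclearNorm X := by
  obtain ⟨p, q, hp, hq, hX⟩ := exists_svd X
  refine ⟨∑ i, vecMulVec (p i) (q i), fun u v => ?_, ?_⟩
  · have h : u ⬝ᵥ (∑ i, vecMulVec (p i) (q i)) *ᵥ v = ∑ i, (p i ⬝ᵥ u) * (q i ⬝ᵥ v) := by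
      rw [← frob_vecMulVec_left, frob_sum_right]
      refine sum_congr rfl fun i _ => ?_
      rw [frob_vecMulVec_right, vecMulVec_mulVec]
      simp [dotProduct_comm, mul_comm]
    rw [h]
    have h1 := hp.bessel u
    have h2 := hq.bessel v
    have h3 : 2 * ∑ i, (p i ⬝ᵥ u) * (q i ⬝ᵥ v) ≤
        ∑ i, (p i ⬝ᵥ u) ^ 2 + ∑ i, (q i ⬝ᵥ v) ^ 2 := by
      rw [mul_sum, ← sum_add_distrib]
      exact sum_le_sum fun i _ => by nlinarith [sq_nonneg (p i ⬝ᵥ u - q i ⬝ᵥ v)]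
    linarith
  · rw [nuclearNorm_eq_sum]
    refine (congrArg (frob _) hX).trans ?_
    rw [frob_sum_right]
    refine sum_congr rfl fun i _ => ?_
    rw [frob_smul_right, frob_comm, frob_sum_right]
    have : ∀ j, frob (vecMulVec (p i) (q i)) (vecMulVec (p j) (q j)) = if j = i then 1 else 0 := by
      intro j
      rw [frob_vecMulVec_right, vecMulVec_mulVec]
      simp only [op_smul_eq_smul, dotProduct_smul, smul_eq_mul, hp j i, hq i j]
      by_cases h : j = i
      · simp [h]
      · simp [h, Ne.symm h]
    simp [this]

theorem OpBound.frob_le {W : Matrix (Fin m) (Fin n) ℝ} {c : ℝ} (hW : OpBound W c)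
    (X : Matrix (Fin m) (Fin n) ℝ) : frob W X ≤ c * nuclearNorm X := by
  obtain ⟨p, q, hp, hq, hX⟩ := exists_svd X
  rw [nuclearNorm_eq_sum, mul_sum]
  conv_lhs => rw [hX]
  rw [frob_sum_right]
  refine sum_le_sum fun i _ => ?_
  rw [frob_smul_right, frob_vecMulVec_right, mul_comm c]
  refine mul_le_mul_of_nonneg_left ?_ (sigma_nonneg _ _)
  have := hW (p i) (q i)
  rw [hp, hq] at this
  simp at this
  linarith

/-- A contraction that norms the perturbed matrix is tested on the two summands separately. -/
theorem nuclearNorm_add_smul_vecMulVec_le (X : Matrix (Fin m) (Fin n) ℝ) {t : ℝ} (ht : 0 ≤ t)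
    (u : Fin m → ℝ) (v : Fin n → ℝ) :
    nuclearNorm (X + t • vecMulVec u v) ≤ nuclearNorm X + t * ((u ⬝ᵥ u + v ⬝ᵥ v) / 2) := by
  obtain ⟨W, hW, h⟩ := exists_opBound_frob_eq_nuclearNorm (X + t • vecMulVec u v)
  rw [← h, frob_add_right, frob_smul_right, frob_vecMulVec_right]
  have h1 := hW.frob_le X
  have h2 := mul_le_mul_of_nonneg_left (hW u v) ht
  linarith

theorem nuclearNorm_smul_le (X : Matrix (Fin m) (Fin n) ℝ) {t : ℝ} (ht : 0 ≤ t) :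
    nuclearNorm (t • X) ≤ t * nuclearNorm X := by
  obtain ⟨W, hW, h⟩ := exists_opBound_frob_eq_nuclearNorm (t • X)
  rw [← h, frob_smul_right]
  have h1 := hW.frob_le X
  gcongr
  linarith

/-- A bound on unit vectors orthogonal to `p` and `q` extends to all vectors orthogonal to
`p` and `q`. -/
theorem two_mul_dot_le_of_unit {W : Matrix (Fin m) (Fin n) ℝ} {c : ℝ} (hc : 0 ≤ c)
    {p : Fin m → ℝ} {q : Fin n → ℝ}
    (h : ∀ u v, u ⬝ᵥ u = 1 → v ⬝ᵥ v = 1 → p ⬝ᵥ u = 0 → q ⬝ᵥ v = 0 → u ⬝ᵥ W *ᵥ v ≤ c)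
    (u : Fin m → ℝ) (v : Fin n → ℝ) (hu : p ⬝ᵥ u = 0) (hv : q ⬝ᵥ v = 0) :
    2 * (u ⬝ᵥ W *ᵥ v) ≤ c * (u ⬝ᵥ u + v ⬝ᵥ v) := by
  have hu0 := dot_self_nonneg u
  have hv0 := dot_self_nonneg v
  rcases hu0.eq_or_lt with h0 | h0
  · rw [dotProduct_self_eq_zero.1 h0.symm]
    simp
    positivity
  rcases hv0.eq_or_lt with h1 | h1
  · rw [dotProduct_self_eq_zero.1 h1.symm]
    simp
    positivity
  have key := h ((√(u ⬝ᵥ u))⁻¹ • u) ((√(v ⬝ᵥ v))⁻¹ • v) ?_ ?_ (by simp [hu]) (by simp [hv])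
  · have a0 := Real.sqrt_pos.2 h0
    have b0 := Real.sqrt_pos.2 h1
    have a2 := Real.sq_sqrt h0.le
    have b2 := Real.sq_sqrt h1.le
    rw [mulVec_smul, smul_dotProduct, dotProduct_smul, smul_eq_mul, smul_eq_mul] at key
    generalize √(u ⬝ᵥ u) = a at *
    generalize √(v ⬝ᵥ v) = b at *
    have : u ⬝ᵥ W *ᵥ v ≤ c * (a * b) := by
      have := mul_le_mul_of_nonneg_right key (mul_pos a0 b0).le
      have e : a⁻¹ * (b⁻¹ * (u ⬝ᵥ W *ᵥ v)) * (a * b) = u ⬝ᵥ W *ᵥ v := by field_simp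
      rwa [e] at this
    rw [← a2, ← b2]
    -- `2ab ≤ a² + b²` removes the square roots.
    nlinarith [mul_nonneg hc (sq_nonneg (a - b))]
  · have := Real.sq_sqrt h0.le
    rw [smul_dotProduct, dotProduct_smul, smul_eq_mul, smul_eq_mul]
    have := (Real.sqrt_pos.2 h0).ne'
    field_simp
    linarith
  · have := Real.sq_sqrt h1.le
    rw [smul_dotProduct, dotProduct_smul, smul_eq_mul, smul_eq_mul]
    have := (Real.sqrt_pos.2 h1).ne'
    field_simp
    linarith

end svd

/-! ### Low-rank approximation -/

section approximation

variable {m n k l : ℕ}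

theorem sum_mulVec_sq_add_residual {e : Fin l → Fin n → ℝ} (he : Ortho e)
    (M : Matrix (Fin m) (Fin n) ℝ) :
    ∑ i, (M i - ∑ j, (e j ⬝ᵥ M i) • e j) ⬝ᵥ (M i - ∑ j, (e j ⬝ᵥ M i) • e j) =
      frob M M - ∑ j, (M *ᵥ e j) ⬝ᵥ (M *ᵥ e j) := by
  simp only [he.residual_sq, frob, sum_sub_distrib]
  rw [sum_comm]
  congr 1
  refine sum_congr rfl fun j _ => ?_
  simp only [dotProduct, mulVec, sq]
  exact sum_congr rfl fun i _ => by simp only [mul_comm (e j _)]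

/-- Approximating `M` by a matrix with row space spanned by the orthonormal family `e`
costs at least the part of `M` outside that row space. -/
theorem frob_sub_sum_mulVec_sq_le {e : Fin l → Fin n → ℝ} (he : Ortho e) (a : Fin l → Fin m → ℝ)
    (M : Matrix (Fin m) (Fin n) ℝ) :
    frob M M - ∑ j, (M *ᵥ e j) ⬝ᵥ (M *ᵥ e j) ≤
      frob (M - ∑ j, vecMulVec (a j) (e j)) (M - ∑ j, vecMulVec (a j) (e j)) := by
  set N := M - ∑ j, vecMulVec (a j) (e j) with hN
  have hrow : ∀ i, M i - ∑ j, (e j ⬝ᵥ M i) • e j = N i - ∑ j, (e j ⬝ᵥ N i) • e j := by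
    intro i
    have h1 : M i = N i + ∑ j, a j i • e j := by
      ext x
      simp [hN, Matrix.sum_apply, vecMulVec_apply]
    simp only [h1, dotProduct_add, he.dot_sum, add_smul, sum_add_distrib]
    abel
  have h1 := sum_mulVec_sq_add_residual he M
  have h2 := sum_mulVec_sq_add_residual he N
  simp only [hrow] at h1
  have h3 : 0 ≤ ∑ j, (N *ᵥ e j) ⬝ᵥ (N *ᵥ e j) := sum_nonneg fun j _ => dot_self_nonneg _
  linarith

theorem OpBound.mulVec_sq_le {W : Matrix (Fin m) (Fin n) ℝ} (hW : OpBound W 1) (v : Fin n → ℝ) :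
    (W *ᵥ v) ⬝ᵥ (W *ᵥ v) ≤ v ⬝ᵥ v := by
  have := hW (W *ᵥ v) v
  linarith

/-- Besides the `s i`, the singular values of `X + σ W` are at most `σ = s l`, so a row space of
dimension `l + 1` captures at most the energy of the first `l + 1` of the `s i`. Since `W ⟂ X`, the
terms `σ² ‖W‖²` cancel on expanding `‖X + σ W - Y‖²`, leaving the cross term `2 σ ⟨W, Y⟩`. -/
theorem frob_add_tail_le {p : Fin k → Fin m → ℝ} {q : Fin k → Fin n → ℝ} (hp : Ortho p)
    (hq : Ortho q) (s : Fin k → ℝ) (hs : Antitone s) (hs0 : ∀ i, 0 ≤ s i) (l : ℕ) (hl : l < k)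
    {e : Fin (l + 1) → Fin n → ℝ} (he : Ortho e) (a : Fin (l + 1) → Fin m → ℝ)
    {W : Matrix (Fin m) (Fin n) ℝ} (hW : OpBound W 1) (hWq : ∀ i, W *ᵥ q i = 0)
    (hWp : ∀ i v, p i ⬝ᵥ W *ᵥ v = 0) (X Y : Matrix (Fin m) (Fin n) ℝ)
    (hX : X = ∑ i, s i • vecMulVec (p i) (q i)) (hY : Y = ∑ j, vecMulVec (a j) (e j)) :
    2 * s ⟨l, hl⟩ * frob W Y + ∑ i : Fin k, (if l < i then s i ^ 2 else 0) ≤ ‖X - Y‖ ^ 2 := by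
  set σ := s ⟨l, hl⟩ with hσ
  have hXv : ∀ v, X *ᵥ v = ∑ i, (s i * (q i ⬝ᵥ v)) • p i := by
    intro v
    rw [hX, sum_mulVec]
    refine sum_congr rfl fun i _ => ?_
    rw [smul_mulVec, vecMulVec_mulVec, op_smul_eq_smul, smul_smul]
  have hWX : frob W X = 0 := by
    rw [hX, frob_sum_right]
    refine sum_eq_zero fun i _ => ?_
    rw [frob_smul_right, frob_vecMulVec_right, hWp, mul_zero]
  have hXX : frob X X = ∑ i, s i ^ 2 := by
    nth_rw 2 [hX]
    rw [frob_sum_right]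
    refine sum_congr rfl fun i _ => ?_
    rw [frob_smul_right, frob_vecMulVec_right, hXv, hp.dot_sum, hq]
    simp [sq]
  have hWe : ∀ v, (W *ᵥ v) ⬝ᵥ (W *ᵥ v) ≤ v ⬝ᵥ v - ∑ i, (q i ⬝ᵥ v) ^ 2 := by
    intro v
    have h1 : W *ᵥ v = W *ᵥ (v - ∑ i, (q i ⬝ᵥ v) • q i) := by
      rw [mulVec_sub, mulVec_sum]
      simp [mulVec_smul, hWq]
    rw [h1, ← hq.residual_sq]
    exact hW.mulVec_sq_le _
  have hM : ∀ v, ((X + σ • W) *ᵥ v) ⬝ᵥ ((X + σ • W) *ᵥ v) ≤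
      ∑ i, (s i ^ 2 - σ ^ 2) * (q i ⬝ᵥ v) ^ 2 + σ ^ 2 * (v ⬝ᵥ v) := by
    intro v
    have h1 : (X *ᵥ v) ⬝ᵥ (W *ᵥ v) = 0 := by
      rw [hXv, sum_dotProduct]
      exact sum_eq_zero fun i _ => by rw [smul_dotProduct, hWp, smul_zero]
    have h2 : (X *ᵥ v) ⬝ᵥ (X *ᵥ v) = ∑ i, s i ^ 2 * (q i ⬝ᵥ v) ^ 2 := by
      rw [hXv, hp.sum_dot_sum]
      exact sum_congr rfl fun i _ => by ring
    rw [add_mulVec, smul_mulVec, add_dotProduct, dotProduct_add, dotProduct_add, smul_dotProduct,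
      smul_dotProduct, dotProduct_smul, dotProduct_smul, dotProduct_comm (W *ᵥ v) (X *ᵥ v), h1, h2]
    have h3 := mul_le_mul_of_nonneg_left (hWe v) (sq_nonneg σ)
    simp only [sub_mul, sum_sub_distrib, ← mul_sum, smul_eq_mul]
    linarith
  have hsum : ∑ j, ((X + σ • W) *ᵥ e j) ⬝ᵥ ((X + σ • W) *ᵥ e j) ≤
      ∑ i, (s i ^ 2 - if l < i then s i ^ 2 else 0) := by
    calc _ ≤ ∑ j, (∑ i, (s i ^ 2 - σ ^ 2) * (q i ⬝ᵥ e j) ^ 2 + σ ^ 2 * (e j ⬝ᵥ e j)) :=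
          sum_le_sum fun j _ => hM (e j)
      _ = ∑ i, (s i ^ 2 - σ ^ 2) * ∑ j, (e j ⬝ᵥ q i) ^ 2 + (l + 1) * σ ^ 2 := by
          rw [sum_add_distrib, sum_comm]
          congr 1
          · refine sum_congr rfl fun i _ => ?_
            rw [mul_sum]
            exact sum_congr rfl fun j _ => by rw [dotProduct_comm]
          · simp [he _ _]
      _ ≤ ∑ i : Fin k, (if l < i then 0 else (s i ^ 2 - σ ^ 2)) + (l + 1) * σ ^ 2 := by
          gcongr with i
          -- The weight of `s i ^ 2 - σ ^ 2` lies in `[0, 1]`: it is replaced by `1` where that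
          -- factor is nonnegative (`i ≤ l`), and by `0` where it is nonpositive.
          have hπ := he.bessel (q i)
          rw [hq, if_pos rfl] at hπ
          have hπ0 : 0 ≤ ∑ j, (e j ⬝ᵥ q i) ^ 2 := by positivity
          split_ifs with h
          · have : s i ≤ σ := hs (Fin.le_def.2 h.le)
            have : s i ^ 2 ≤ σ ^ 2 := by gcongr; exact hs0 i
            exact mul_nonpos_of_nonpos_of_nonneg (by linarith) hπ0
          · have : σ ≤ s i := hs (Fin.le_def.2 (not_lt.1 h))
            have : σ ^ 2 ≤ s i ^ 2 := by gcongr; exact hs0 _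
            nlinarith
      _ = _ := by
          have hc : ∑ i : Fin k, (if l < i then 0 else σ ^ 2) = (l + 1) * σ ^ 2 := by
            rw [Fin.sum_univ_eq_sum_range (fun i => if l < i then 0 else σ ^ 2)]
            have : (range k).filter (fun i => ¬ l < i) = range (l + 1) := by
              ext x; simp; omega
            rw [sum_ite, sum_const_zero, zero_add, this]
            simp
          rw [← hc, ← sum_add_distrib]
          refine sum_congr rfl fun i _ => ?_
          split_ifs <;> ring
  have happ := frob_sub_sum_mulVec_sq_le he a (X + σ • W)
  rw [← hY] at happ
  rw [norm_sq_eq_frob]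
  have e1 : frob (X + σ • W - Y) (X + σ • W - Y) =
      frob (X - Y) (X - Y) - 2 * σ * frob W Y + σ ^ 2 * frob W W := by
    simp only [frob_sub_left, frob_sub_right, frob_add_left, frob_add_right, frob_smul_left,
      frob_smul_right, hWX, frob_comm X W, frob_comm Y W]
    ring
  have e2 : frob (X + σ • W) (X + σ • W) = frob X X + σ ^ 2 * frob W W := by
    simp only [frob_add_left, frob_add_right, frob_smul_left,
      frob_smul_right, hWX, frob_comm X W]
    ring
  rw [e1, e2, hXX] at happ
  rw [sum_sub_distrib] at hsum
  linarith

end approximation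

/-! ### First and second derivatives of `f(Φ(p, p)) + Ψ(p, p)` -/

section calculus

variable {E M : Type*} [NormedAddCommGroup E] [NormedSpace ℝ E] [NormedAddCommGroup M]
  [NormedSpace ℝ M]

theorem hasDerivAt_line (x u : E) (t : ℝ) : HasDerivAt (fun t : ℝ => x + t • u) u t := by
  simpa using ((hasDerivAt_id t).smul_const u).const_add x

/-- The Hessian is the derivative of the directional derivative along a line. -/
theorem hasDerivAt_dirDeriv_line {f : E → ℝ} (hf : Differentiable ℝ (fderiv ℝ f)) (x u : E) :
    HasDerivAt (fun t : ℝ => dirDeriv f (x + t • u) u) (hess f x u) 0 := by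
  have h1 : HasDerivAt (fun t : ℝ => fderiv ℝ f (x + t • u)) (fderiv ℝ (fderiv ℝ f) x u) 0 :=
    (hf x).hasFDerivAt.comp_hasDerivAt_of_eq 0 (hasDerivAt_line x u 0) (by simp)
  have h2 : HasDerivAt (fun t : ℝ => fderiv ℝ f (x + t • u) u)
      (fderiv ℝ (fderiv ℝ f) x u u + fderiv ℝ f (x + (0 : ℝ) • u) 0) 0 :=
    h1.clm_apply (hasDerivAt_const 0 u)
  rwa [map_zero, add_zero] at h2

theorem hess_smul (f : E → ℝ) (x u : E) (c : ℝ) : hess f x (c • u) = c ^ 2 * hess f x u := by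
  simp [hess]
  ring

theorem dirDeriv_smul (f : E → ℝ) (x u : E) (c : ℝ) :
    dirDeriv f x (c • u) = c * dirDeriv f x u := by
  simp [dirDeriv]

/-- If `f` cannot decrease along `u` faster than `K`, its directional derivative is at
least `-K`. -/
theorem dirDeriv_add_nonneg {f : E → ℝ} (hf : Differentiable ℝ f) {x u : E} {K : ℝ}
    (h : ∀ t : ℝ, 0 < t → t < 1 → f x ≤ f (x + t • u) + t * K) : 0 ≤ dirDeriv f x u + K := by
  have h1 : HasFDerivAt f (fderiv ℝ f x) (x + (0 : ℝ) • u) := by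
    simpa using (hf x).hasFDerivAt
  have h2 := (h1.comp_hasDerivAt 0 (hasDerivAt_line x u 0)).tendsto_slope_zero_right
  have h3 : -K ≤ fderiv ℝ f x u := by
    refine ge_of_tendsto h2 ?_
    filter_upwards [Ioo_mem_nhdsGT (zero_lt_one' ℝ)] with t ht
    have := h t ht.1 ht.2
    simp only [Function.comp_apply, zero_add, zero_smul, add_zero, smul_eq_mul]
    rw [inv_mul_eq_div, le_div_iff₀ ht.1]
    linarith
  rw [dirDeriv]
  linarith

/-- Strong monotonicity of the gradient along a short segment bounds the Hessian below. -/
theorem mul_norm_sq_le_hess {f : E → ℝ} (hf : Differentiable ℝ (fderiv ℝ f)) {x u : E}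
    {a ε : ℝ} (hε : 0 < ε) (h : ∀ t : ℝ, 0 < t → t < ε →
      a * ‖t • u‖ ^ 2 ≤ dirDeriv f (x + t • u) (t • u) - dirDeriv f x (t • u)) :
    a * ‖u‖ ^ 2 ≤ hess f x u := by
  refine ge_of_tendsto (hasDerivAt_dirDeriv_line hf x u).tendsto_slope_zero_right ?_
  filter_upwards [Ioo_mem_nhdsGT hε] with t ht
  have := h t ht.1 ht.2
  have h0 := ht.1
  rw [dirDeriv_smul, dirDeriv_smul, norm_smul, mul_pow, Real.norm_eq_abs, sq_abs] at this
  simp only [zero_add, zero_smul, add_zero, smul_eq_mul]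
  rw [inv_mul_eq_div, le_div_iff₀ h0]
  nlinarith

variable (Φ : E →L[ℝ] E →L[ℝ] M) (Ψ : E →L[ℝ] E →L[ℝ] ℝ)

theorem hasFDerivAt_quadratic (p : E) :
    HasFDerivAt (fun p => Φ p p) (Φ p + Φ.flip p) p := by
  convert! Φ.hasFDerivAt (x := p) |>.clm_apply (hasFDerivAt_id p) using 1

theorem hasFDerivAt_comp_quadratic {f : M → ℝ} (hf : Differentiable ℝ f) (p : E) :
    HasFDerivAt (fun p => f (Φ p p) + Ψ p p)
      ((fderiv ℝ f (Φ p p)).comp (Φ p + Φ.flip p) + (Ψ p + Ψ.flip p)) p :=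
  (HasFDerivAt.comp (f := fun p => Φ p p) p (hf (Φ p p)).hasFDerivAt
    (hasFDerivAt_quadratic Φ p)).add (hasFDerivAt_quadratic Ψ p)

theorem dirDeriv_comp_quadratic {f : M → ℝ} (hf : Differentiable ℝ f) (p u : E) :
    dirDeriv (fun p => f (Φ p p) + Ψ p p) p u =
      dirDeriv f (Φ p p) (Φ p u + Φ u p) + (Ψ p u + Ψ u p) := by
  rw [dirDeriv, (hasFDerivAt_comp_quadratic Φ Ψ hf p).fderiv]
  simp [dirDeriv]

theorem hess_comp_quadratic {f : M → ℝ} (hf : TwiceDifferentiable f) (p u : E) :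
    hess (fun p => f (Φ p p) + Ψ p p) p u =
      hess f (Φ p p) (Φ p u + Φ u p) + 2 * dirDeriv f (Φ p p) (Φ u u) + 2 * Ψ u u := by
  have hd : Differentiable ℝ (fderiv ℝ (fun p => f (Φ p p) + Ψ p p)) := by
    rw [funext fun p => (hasFDerivAt_comp_quadratic Φ Ψ hf.1 p).fderiv]
    intro p
    have h1 : DifferentiableAt ℝ (fun p => fderiv ℝ f (Φ p p)) p :=
      DifferentiableAt.comp (f := fun p => Φ p p) p (hf.2 _) (hasFDerivAt_quadratic Φ p).differentiableAt
    exact (h1.clm_comp (Φ + Φ.flip).differentiableAt).add (Ψ + Ψ.flip).differentiableAt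
  refine (hasDerivAt_dirDeriv_line hd p u).unique ?_
  simp only [dirDeriv_comp_quadratic Φ Ψ hf.1]
  have hpt : p + (0 : ℝ) • u = p := by simp
  have h1 := (hasFDerivAt_quadratic Φ (p + (0 : ℝ) • u)).comp_hasDerivAt 0 (hasDerivAt_line p u 0)
  have h2 : HasFDerivAt (fderiv ℝ f) (fderiv ℝ (fderiv ℝ f) (Φ p p))
      (((fun p => Φ p p) ∘ fun t : ℝ => p + t • u) 0) := by
    simp only [Function.comp_apply, hpt]
    exact (hf.2 _).hasFDerivAt
  have h3 := h2.comp_hasDerivAt 0 h1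
  -- The direction fed to `fderiv f` is itself affine in `t` with velocity `2 Φ u u`; this produces
  -- the gradient term of the Hessian.
  have h4 := hasDerivAt_line (Φ p u + Φ u p) ((2 : ℝ) • Φ u u) 0
  have h5 := h3.clm_apply h4
  have h6 := hasDerivAt_line (Ψ p u + Ψ u p) (2 * Ψ u u) 0
  convert! h5.add h6 using 1
  · ext t
    simp only [Pi.add_apply, Function.comp_apply, dirDeriv, map_add, map_smul,
      _root_.add_apply, _root_.smul_apply, smul_eq_mul]
    ring
  · simp [hess, dirDeriv]

end calculus

/-! ### Derivatives of the LoRA loss; optimality conditions for the full loss -/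

section lora

variable {m n r : ℕ}

theorem isBoundedBilinearMap_mul_transpose :
    IsBoundedBilinearMap ℝ (fun x : (Matrix (Fin m) (Fin r) ℝ × Matrix (Fin n) (Fin r) ℝ) ×
      (Matrix (Fin m) (Fin r) ℝ × Matrix (Fin n) (Fin r) ℝ) => x.1.1 * x.2.2ᵀ) where
  add_left _ _ _ := Matrix.add_mul _ _ _
  smul_left _ _ _ := Matrix.smul_mul _ _ _
  add_right _ _ _ := by simp [Matrix.mul_add]
  smul_right _ _ _ := by simp
  bound := ⟨1, one_pos, fun x y => by
    rw [one_mul]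
    refine (Matrix.frobenius_norm_mul _ _).trans ?_
    rw [Matrix.frobenius_norm_transpose]
    exact mul_le_mul (norm_fst_le x) (norm_snd_le y) (norm_nonneg _) (norm_nonneg _)⟩

theorem frob_le_norm_mul_norm (X Y : Matrix (Fin m) (Fin n) ℝ) : |frob X Y| ≤ ‖X‖ * ‖Y‖ := by
  rw [← sq_le_sq₀ (abs_nonneg _) (by positivity), sq_abs, mul_pow, norm_sq_eq_frob,
    norm_sq_eq_frob]
  -- Cauchy–Schwarz from the discriminant of `t ↦ ‖X + t Y‖²`.
  have := discrim_le_zero (a := frob Y Y) (b := 2 * frob X Y) (c := frob X X) fun t => by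
    have := frob_self_nonneg (X + t • Y)
    simp only [frob_add_left, frob_add_right, frob_smul_left, frob_smul_right,
      frob_comm Y X] at this
    linarith
  rw [discrim] at this
  linarith

theorem isBoundedBilinearMap_frob_add_frob (lam : ℝ) :
    IsBoundedBilinearMap ℝ (fun x : (Matrix (Fin m) (Fin r) ℝ × Matrix (Fin n) (Fin r) ℝ) ×
      (Matrix (Fin m) (Fin r) ℝ × Matrix (Fin n) (Fin r) ℝ) =>
        lam / 2 * (frob x.1.1 x.2.1 + frob x.1.2 x.2.2)) where
  add_left _ _ _ := by
    simp only [Prod.fst_add, Prod.snd_add, frob_add_left]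
    ring
  smul_left _ _ _ := by
    simp only [Prod.smul_fst, Prod.smul_snd, frob_smul_left, smul_eq_mul]
    ring
  add_right _ _ _ := by
    simp only [Prod.fst_add, Prod.snd_add, frob_add_right]
    ring
  smul_right _ _ _ := by
    simp only [Prod.smul_fst, Prod.smul_snd, frob_smul_right, smul_eq_mul]
    ring
  bound := ⟨|lam / 2| * 2 + 1, by positivity, fun x y => by
    have h1 := (frob_le_norm_mul_norm x.1 y.1).trans
      (mul_le_mul (norm_fst_le x) (norm_fst_le y) (norm_nonneg _) (norm_nonneg _))
    have h2 := (frob_le_norm_mul_norm x.2 y.2).trans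
      (mul_le_mul (norm_snd_le x) (norm_snd_le y) (norm_nonneg _) (norm_nonneg _))
    have h3 : 0 ≤ ‖x‖ * ‖y‖ := by positivity
    rw [Real.norm_eq_abs, abs_mul, mul_assoc]
    have h4 := mul_le_mul_of_nonneg_left ((abs_add_le (frob x.1 y.1) (frob x.2 y.2)).trans
      (add_le_add h1 h2)) (abs_nonneg (lam / 2))
    linarith⟩

theorem loraLoss_eq (f : Matrix (Fin m) (Fin n) ℝ → ℝ) (lam : ℝ) :
    loraLoss (r := r) f lam = fun p =>
      f (isBoundedBilinearMap_mul_transpose.toContinuousLinearMap p p) +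
        (isBoundedBilinearMap_frob_add_frob lam).toContinuousLinearMap p p := by
  ext p
  simp only [loraLoss, IsBoundedBilinearMap.toContinuousLinearMap_apply, norm_sq_eq_frob]

theorem dirDeriv_loraLoss {f : Matrix (Fin m) (Fin n) ℝ → ℝ} (hf : TwiceDifferentiable f)
    (lam : ℝ) (p u : Matrix (Fin m) (Fin r) ℝ × Matrix (Fin n) (Fin r) ℝ) :
    dirDeriv (loraLoss f lam) p u = dirDeriv f (p.1 * p.2ᵀ) (p.1 * u.2ᵀ + u.1 * p.2ᵀ) +
      lam * (frob p.1 u.1 + frob p.2 u.2) := by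
  rw [loraLoss_eq, dirDeriv_comp_quadratic _ _ hf.1]
  simp only [IsBoundedBilinearMap.toContinuousLinearMap_apply, frob_comm u.1, frob_comm u.2]
  ring

theorem hess_loraLoss {f : Matrix (Fin m) (Fin n) ℝ → ℝ} (hf : TwiceDifferentiable f)
    (lam : ℝ) (p u : Matrix (Fin m) (Fin r) ℝ × Matrix (Fin n) (Fin r) ℝ) :
    hess (loraLoss f lam) p u = hess f (p.1 * p.2ᵀ) (p.1 * u.2ᵀ + u.1 * p.2ᵀ) +
      2 * dirDeriv f (p.1 * p.2ᵀ) (u.1 * u.2ᵀ) + lam * (frob u.1 u.1 + frob u.2 u.2) := by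
  rw [loraLoss_eq, hess_comp_quadratic _ _ hf]
  simp only [IsBoundedBilinearMap.toContinuousLinearMap_apply]
  ring

/-- The gradient as a matrix. -/
theorem exists_dirDeriv_eq_frob (f : Matrix (Fin m) (Fin n) ℝ → ℝ)
    (X : Matrix (Fin m) (Fin n) ℝ) : ∃ G, ∀ U, dirDeriv f X U = frob G U :=
  exists_frob_eq
    { toFun := dirDeriv f X
      map_add' := fun _ _ => by simp [dirDeriv]
      map_smul' := fun _ _ => by simp [dirDeriv] }

/-- Rank-one perturbations `t u vᵀ` raise the nuclear norm by at most `t (|u|² + |v|²) / 2`. -/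
theorem opBound_neg_of_isGlobalMin {f : Matrix (Fin m) (Fin n) ℝ → ℝ} (hf : Differentiable ℝ f)
    {lam : ℝ} (hlam : 0 ≤ lam) {X G : Matrix (Fin m) (Fin n) ℝ}
    (hX : IsGlobalMin (fullLoss f lam) X) (hG : ∀ U, dirDeriv f X U = frob G U) :
    OpBound (-G) lam := by
  intro u v
  have := dirDeriv_add_nonneg (x := X) (u := vecMulVec u v)
    (K := lam * ((u ⬝ᵥ u + v ⬝ᵥ v) / 2)) hf fun t ht _ => by
      have h1 := hX (X + t • vecMulVec u v)
      have h2 := mul_le_mul_of_nonneg_left (nuclearNorm_add_smul_vecMulVec_le X ht.le u v) hlam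
      simp only [fullLoss] at h1
      linarith
  rw [hG, frob_vecMulVec_right] at this
  rw [neg_mulVec, dotProduct_neg]
  linarith

/-- Obtained by shrinking `X` to `(1 - t) X`. -/
theorem frob_le_of_isGlobalMin {f : Matrix (Fin m) (Fin n) ℝ → ℝ} (hf : Differentiable ℝ f)
    {lam : ℝ} (hlam : 0 ≤ lam) {X G : Matrix (Fin m) (Fin n) ℝ}
    (hX : IsGlobalMin (fullLoss f lam) X) (hG : ∀ U, dirDeriv f X U = frob G U) :
    frob G X ≤ -(lam * nuclearNorm X) := by
  have := dirDeriv_add_nonneg (x := X) (u := -X)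
    (K := -(lam * nuclearNorm X)) hf fun t ht ht1 => by
      have e : X + t • -X = (1 - t) • X := by module
      have h1 := hX (X + t • -X)
      have h2 := mul_le_mul_of_nonneg_left (nuclearNorm_smul_le X (sub_nonneg.2 ht1.le)) hlam
      simp only [fullLoss] at h1
      rw [e] at h1 ⊢
      linarith
  rw [hG, frob_neg_right] at this
  linarith

end lora

/-! ### Consequences of first- and second-order stationarity -/

section stationary

variable {m n r : ℕ}

theorem eq_zero_of_forall_dotProduct {w : Fin m → ℝ} (h : ∀ u, u ⬝ᵥ w = 0) : w = 0 :=
  dotProduct_self_eq_zero.1 (h w)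

theorem mul_vecMulVec_transpose (A : Matrix (Fin m) (Fin r) ℝ) (v : Fin n → ℝ) (b : Fin r → ℝ) :
    A * (vecMulVec v b)ᵀ = vecMulVec (A *ᵥ b) v := by
  rw [transpose_vecMulVec, mul_vecMulVec]

theorem vecMulVec_mul_transpose (B : Matrix (Fin n) (Fin r) ℝ) (u : Fin m → ℝ) (a : Fin r → ℝ) :
    vecMulVec u a * Bᵀ = vecMulVec u (B *ᵥ a) := by
  rw [vecMulVec_mul, vecMul_transpose]

variable {f : Matrix (Fin m) (Fin n) ℝ → ℝ} {lam : ℝ} {A : Matrix (Fin m) (Fin r) ℝ}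
  {B : Matrix (Fin n) (Fin r) ℝ} {G : Matrix (Fin m) (Fin n) ℝ}

theorem IsSOSP.grad_mul_right (h : IsSOSP (loraLoss f lam) (A, B)) (hf : TwiceDifferentiable f)
    (hG : ∀ U, dirDeriv f (A * Bᵀ) U = frob G U) : G * B = -(lam • A) := by
  refine ext_of_mulVec_single fun i => ?_
  generalize (Pi.single i (1 : ℝ) : Fin r → ℝ) = a
  rw [← sub_eq_zero]
  refine eq_zero_of_forall_dotProduct fun u => ?_
  have h1 := h.1 (vecMulVec u a, 0)
  rw [dirDeriv_loraLoss hf] at h1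
  simp only [transpose_zero, Matrix.mul_zero, zero_add, vecMulVec_mul_transpose, hG,
    frob_vecMulVec_right] at h1
  have h2 : frob B (0 : Matrix (Fin n) (Fin r) ℝ) = 0 := by simp [frob, dotProduct]
  rw [h2] at h1
  rw [neg_mulVec, smul_mulVec, ← mulVec_mulVec, sub_neg_eq_add, dotProduct_add, dotProduct_smul,
    smul_eq_mul]
  linarith

theorem IsSOSP.grad_mul_left (h : IsSOSP (loraLoss f lam) (A, B)) (hf : TwiceDifferentiable f)
    (hG : ∀ U, dirDeriv f (A * Bᵀ) U = frob G U) : Gᵀ * A = -(lam • B) := by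
  refine ext_of_mulVec_single fun i => ?_
  generalize (Pi.single i (1 : ℝ) : Fin r → ℝ) = b
  rw [← sub_eq_zero]
  refine eq_zero_of_forall_dotProduct fun v => ?_
  have h1 := h.1 (0, vecMulVec v b)
  rw [dirDeriv_loraLoss hf] at h1
  simp only [Matrix.zero_mul, add_zero, mul_vecMulVec_transpose, hG,
    frob_vecMulVec_right] at h1
  have h2 : frob A (0 : Matrix (Fin m) (Fin r) ℝ) = 0 := by simp [frob, dotProduct]
  rw [h2] at h1
  rw [neg_mulVec, smul_mulVec, ← mulVec_mulVec, sub_neg_eq_add, dotProduct_add, dotProduct_smul,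
    smul_eq_mul, mulVec_transpose, dotProduct_comm, ← dotProduct_mulVec]
  linarith

theorem IsSOSP.second_order (h : IsSOSP (loraLoss f lam) (A, B)) (hf : TwiceDifferentiable f)
    (hG : ∀ U, dirDeriv f (A * Bᵀ) U = frob G U) (u : Fin m → ℝ) (v : Fin n → ℝ)
    (a b : Fin r → ℝ) :
    0 ≤ hess f (A * Bᵀ) (vecMulVec u (B *ᵥ a) + vecMulVec (A *ᵥ b) v) +
      2 * ((a ⬝ᵥ b) * (u ⬝ᵥ G *ᵥ v)) +
      lam * ((u ⬝ᵥ u) * (a ⬝ᵥ a) + (v ⬝ᵥ v) * (b ⬝ᵥ b)) := by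
  have h1 := h.2 (vecMulVec u a, vecMulVec v b)
  rw [hess_loraLoss hf] at h1
  simp only [mul_vecMulVec_transpose, vecMulVec_mul_transpose, ← norm_sq_eq_frob,
    norm_sq_vecMulVec] at h1
  rw [vecMulVec_mulVec, op_smul_eq_smul, smul_vecMulVec, dirDeriv_smul, hG, frob_vecMulVec_right,
    add_comm (vecMulVec (A *ᵥ b) v)] at h1
  exact h1

/-- `(G * B)ᵀ * A` is evaluated with either equation; dividing by `lam` needs `lam ≠ 0`. -/
theorem balanced_of_grad (hlam : 0 < lam) (h1 : G * B = -(lam • A)) (h2 : Gᵀ * A = -(lam • B)) :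
    Aᵀ * A = Bᵀ * B := by
  have e1 : (G * B)ᵀ * A = -(lam • (Aᵀ * A)) := by
    rw [h1]; simp
  have e2 : (G * B)ᵀ * A = -(lam • (Bᵀ * B)) := by
    rw [transpose_mul, Matrix.mul_assoc, h2]; simp
  rw [e1] at e2
  exact smul_right_injective _ hlam.ne' (neg_injective e2)

/-- Balancedness gives `(A Aᵀ)² = X Xᵀ`, so `A Aᵀ` is the positive square root. The defect `w`
satisfies `A Aᵀ w = -s w`, which positivity excludes unless `w = 0`. -/
theorem balanced_mulVec (hbal : Aᵀ * A = Bᵀ * B) {s : ℝ} (hs : 0 < s) {p : Fin m → ℝ}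
    {q : Fin n → ℝ} (hq : (A * Bᵀ) *ᵥ q = s • p) (hp : (A * Bᵀ)ᵀ *ᵥ p = s • q) :
    (A * Aᵀ) *ᵥ p = s • p := by
  rw [← sub_eq_zero]
  set w := (A * Aᵀ) *ᵥ p - s • p with hw
  have h1 : (A * Aᵀ) *ᵥ ((A * Aᵀ) *ᵥ p) = s • s • p := by
    have : A * Aᵀ * (A * Aᵀ) = A * Bᵀ * (A * Bᵀ)ᵀ := by
      rw [transpose_mul, transpose_transpose, Matrix.mul_assoc, ← Matrix.mul_assoc Aᵀ, hbal]
      simp only [Matrix.mul_assoc]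
    rw [mulVec_mulVec, this, ← mulVec_mulVec, hp, mulVec_smul, hq]
  have h2 : (A * Aᵀ) *ᵥ w = -(s • w) := by
    rw [hw, mulVec_sub, mulVec_smul, h1, smul_sub]
    abel
  have h3 : w ⬝ᵥ (A * Aᵀ) *ᵥ w = (Aᵀ *ᵥ w) ⬝ᵥ (Aᵀ *ᵥ w) := by
    rw [← mulVec_mulVec, dotProduct_mulVec, ← mulVec_transpose]
  rw [h2, dotProduct_neg, dotProduct_smul, smul_eq_mul] at h3
  have h4 := dot_self_nonneg (Aᵀ *ᵥ w)
  have h5 := dot_self_nonneg w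
  exact dotProduct_self_eq_zero.1 (by nlinarith)

/-- The factor `lam` is kept so that `lam = 0`, where balancedness may fail, needs no separate
treatment later. -/
theorem smul_balanced_mulVec (hlam : 0 ≤ lam) (h1 : G * B = -(lam • A))
    (h2 : Gᵀ * A = -(lam • B)) {s : ℝ} (hs : 0 < s) {p : Fin m → ℝ}
    {q : Fin n → ℝ} (hq : (A * Bᵀ) *ᵥ q = s • p) (hp : (A * Bᵀ)ᵀ *ᵥ p = s • q) :
    lam • ((A * Aᵀ) *ᵥ p) = lam • s • p ∧ lam • ((B * Bᵀ) *ᵥ q) = lam • s • q := by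
  rcases hlam.eq_or_lt with rfl | hlam
  · simp
  · have hbal := balanced_of_grad hlam h1 h2
    rw [balanced_mulVec hbal hs hq hp, balanced_mulVec (p := q) (q := p) hbal.symm hs]
    · exact ⟨rfl, rfl⟩
    · simpa using hp
    · simpa using hq

/-- `s G q = G B Aᵀ p = -lam A Aᵀ p = -lam s p`, and symmetrically. -/
theorem grad_mulVec_singular (hlam : 0 ≤ lam) (h1 : G * B = -(lam • A))
    (h2 : Gᵀ * A = -(lam • B)) {s : ℝ} (hs : 0 < s) {p : Fin m → ℝ}
    {q : Fin n → ℝ} (hq : (A * Bᵀ) *ᵥ q = s • p) (hp : (A * Bᵀ)ᵀ *ᵥ p = s • q) :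
    G *ᵥ q = -(lam • p) ∧ Gᵀ *ᵥ p = -(lam • q) := by
  obtain ⟨e1, e2⟩ := smul_balanced_mulVec hlam h1 h2 hs hq hp
  constructor <;> refine smul_right_injective _ hs.ne' ?_
  · change s • G *ᵥ q = s • -(lam • p)
    rw [← mulVec_smul, ← hp, mulVec_mulVec, transpose_mul, transpose_transpose,
      ← Matrix.mul_assoc, h1, Matrix.neg_mul, Matrix.smul_mul, neg_mulVec, smul_mulVec, e1,
      smul_neg, smul_comm]
  · change s • Gᵀ *ᵥ p = s • -(lam • q)
    rw [← mulVec_smul, ← hq, mulVec_mulVec, ← Matrix.mul_assoc, h2, Matrix.neg_mul,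
      Matrix.smul_mul, neg_mulVec, smul_mulVec, e2, smul_neg, smul_comm]

theorem vecMulVec_zero_right (u : Fin m → ℝ) : vecMulVec u (0 : Fin n → ℝ) = 0 := by
  ext
  simp [vecMulVec_apply]

theorem rank_vecMulVec_eq_one {k l : ℕ} {u : Fin k → ℝ} {v : Fin l → ℝ} (hu : u ≠ 0)
    (hv : v ≠ 0) : (vecMulVec u v).rank = 1 := by
  refine le_antisymm (rank_vecMulVec_le u v) (Nat.one_le_iff_ne_zero.2 fun h => ?_)
  have h0 : vecMulVec u v = 0 := by
    have := (rank_eq_finrank_range_toEuclideanLin (vecMulVec u v)).symm.trans h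
    rw [Submodule.finrank_eq_zero, LinearMap.range_eq_bot] at this
    simpa using this
  have h1 := norm_sq_vecMulVec u v
  rw [h0, norm_zero, zero_pow two_ne_zero, eq_comm, mul_eq_zero, dotProduct_self_eq_zero,
    dotProduct_self_eq_zero] at h1
  exact h1.elim hu hv

theorem ne_zero_of_dot_self_eq_one {k : ℕ} {u : Fin k → ℝ} (h : u ⬝ᵥ u = 1) : u ≠ 0 := by
  rintro rfl
  simp at h

theorem norm_vecMulVec_eq_one {k l : ℕ} {u : Fin k → ℝ} {v : Fin l → ℝ} (hu : u ⬝ᵥ u = 1)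
    (hv : v ⬝ᵥ v = 1) : ‖vecMulVec u v‖ = 1 := by
  rw [← sq_eq_sq₀ (norm_nonneg _) zero_le_one, norm_sq_vecMulVec, hu, hv]
  norm_num

theorem norm_sq_vecMulVec_add {u p : Fin m → ℝ} {q v : Fin n → ℝ} (hu : p ⬝ᵥ u = 0) :
    ‖vecMulVec u q + vecMulVec p v‖ ^ 2 =
      (u ⬝ᵥ u) * (q ⬝ᵥ q) + (p ⬝ᵥ p) * (v ⬝ᵥ v) := by
  rw [norm_sq_eq_frob, frob_add_left, frob_add_right, frob_add_right, ← norm_sq_eq_frob,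
    ← norm_sq_eq_frob, norm_sq_vecMulVec, norm_sq_vecMulVec, frob_vecMulVec_left,
    frob_vecMulVec_left, vecMulVec_mulVec, vecMulVec_mulVec]
  simp [hu, dotProduct_comm u p]

/-- The second-order condition bounds the gradient on vectors orthogonal to a singular pair. -/
theorem IsSOSP.neg_grad_le (h : IsSOSP (loraLoss f lam) (A, B)) (hf : TwiceDifferentiable f)
    (hG : ∀ U, dirDeriv f (A * Bᵀ) U = frob G U) (hlam : 0 ≤ lam) {D β : ℝ}
    {Xs : Matrix (Fin m) (Fin n) ℝ} (hβ : RestrictedSmooth f r D Xs β)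
    (hD : ‖A * Bᵀ - Xs‖ ≤ D) (hr : (A * Bᵀ).rank ≤ r) {s : ℝ} (hs : 0 < s) {p : Fin m → ℝ}
    {q : Fin n → ℝ} (hpp : p ⬝ᵥ p = 1) (hqq : q ⬝ᵥ q = 1) (hq : (A * Bᵀ) *ᵥ q = s • p)
    (hp : (A * Bᵀ)ᵀ *ᵥ p = s • q) {u : Fin m → ℝ} {v : Fin n → ℝ} (hu : u ⬝ᵥ u = 1)
    (hv : v ⬝ᵥ v = 1) (hpu : p ⬝ᵥ u = 0) :
    -(u ⬝ᵥ G *ᵥ v) ≤ lam + β * s := by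
  have h1 := h.grad_mul_right hf hG
  have h2 := h.grad_mul_left hf hG
  obtain ⟨e1, e2⟩ := smul_balanced_mulVec hlam h1 h2 hs hq hp
  -- This scaling gives `a = c Aᵀ p`, `b = c Bᵀ q` with `a ⬝ᵥ b = 1`, `B a = √s q` and `A b = √s p`.
  set c := (√s)⁻¹ with hc
  have hc2 : c ^ 2 * s = 1 := by
    rw [hc, inv_pow, Real.sq_sqrt hs.le, inv_mul_cancel₀ hs.ne']
  have key := h.second_order hf hG u v (c • Aᵀ *ᵥ p) (c • Bᵀ *ᵥ q)
  have hBa : B *ᵥ (c • Aᵀ *ᵥ p) = c • s • q := by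
    rw [mulVec_smul, mulVec_mulVec, ← hp, transpose_mul, transpose_transpose]
  have hAb : A *ᵥ (c • Bᵀ *ᵥ q) = c • s • p := by
    rw [mulVec_smul, mulVec_mulVec, hq]
  have hab : (c • Aᵀ *ᵥ p) ⬝ᵥ (c • Bᵀ *ᵥ q) = 1 := by
    have : (Aᵀ *ᵥ p) ⬝ᵥ (Bᵀ *ᵥ q) = s := by
      rw [mulVec_transpose, ← dotProduct_mulVec, mulVec_mulVec, hq, dotProduct_smul, hpp]
      simp
    rw [smul_dotProduct, dotProduct_smul, this, smul_eq_mul, smul_eq_mul, ← mul_assoc, ← sq, hc2]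
  have haa : lam * ((c • Aᵀ *ᵥ p) ⬝ᵥ (c • Aᵀ *ᵥ p)) = lam := by
    have : lam * ((Aᵀ *ᵥ p) ⬝ᵥ (Aᵀ *ᵥ p)) = lam * s := by
      rw [mulVec_transpose, ← dotProduct_mulVec, ← mulVec_transpose, mulVec_mulVec, ← smul_eq_mul,
        ← dotProduct_smul, e1]
      simp [hpp]
    rw [smul_dotProduct, dotProduct_smul, smul_eq_mul, smul_eq_mul]
    linear_combination c ^ 2 * this + lam * hc2
  have hbb : lam * ((c • Bᵀ *ᵥ q) ⬝ᵥ (c • Bᵀ *ᵥ q)) = lam := by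
    have : lam * ((Bᵀ *ᵥ q) ⬝ᵥ (Bᵀ *ᵥ q)) = lam * s := by
      rw [mulVec_transpose, ← dotProduct_mulVec, ← mulVec_transpose, mulVec_mulVec, ← smul_eq_mul,
        ← dotProduct_smul, e2]
      simp [hqq]
    rw [smul_dotProduct, dotProduct_smul, smul_eq_mul, smul_eq_mul]
    linear_combination c ^ 2 * this + lam * hc2
  -- With `U = u pᵀ`, `V = q vᵀ`, the matrix `U X + X V` is parallel to the Hessian direction.
  have hrsm := hβ _ hD hr (vecMulVec u p) (vecMulVec q v)
    (rank_vecMulVec_eq_one (ne_zero_of_dot_self_eq_one hu) (ne_zero_of_dot_self_eq_one hpp))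
    (norm_vecMulVec_eq_one hu hpp)
    (rank_vecMulVec_eq_one (ne_zero_of_dot_self_eq_one hqq) (ne_zero_of_dot_self_eq_one hv))
    (norm_vecMulVec_eq_one hqq hv)
  have hdir : vecMulVec u p * (A * Bᵀ) + A * Bᵀ * vecMulVec q v =
      s • (vecMulVec u q + vecMulVec p v) := by
    rw [vecMulVec_mul, mul_vecMulVec, hq, ← mulVec_transpose, hp, smul_vecMulVec, vecMulVec_smul,
      smul_add]
  have hdir2 : vecMulVec u (c • s • q) + vecMulVec (c • s • p) v =
      (c * s) • (vecMulVec u q + vecMulVec p v) := by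
    simp only [smul_vecMulVec, vecMulVec_smul, smul_add, smul_smul]
  rw [hdir, hess_smul, norm_smul, mul_pow, norm_sq_vecMulVec_add hpu, hu, hv, hpp, hqq,
    Real.norm_eq_abs, sq_abs] at hrsm
  rw [hBa, hAb, hab, hdir2, hess_smul, hu, hv] at key
  have h3 := mul_le_mul_of_nonneg_left hrsm (sq_nonneg c)
  have e3 : c ^ 2 * (β * (s ^ 2 * (1 * 1 + 1 * 1))) = 2 * (β * s) := by
    linear_combination (2 * β * s) * hc2
  nlinarith

/-- Two injective factors would give `rank (A Bᵀ) = rank Bᵀ = r`. -/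
theorem exists_mulVec_eq_zero_of_rank_lt (h : (A * Bᵀ).rank < r) :
    ∃ w, w ≠ 0 ∧ (A *ᵥ w = 0 ∨ B *ᵥ w = 0) := by
  by_contra! hcon
  have hA : Function.Injective A.mulVecLin := by
    rw [← LinearMap.ker_eq_bot, LinearMap.ker_eq_bot']
    intro w hw
    by_contra h0
    exact (hcon w h0).1 hw
  have hB : Function.Injective B.mulVecLin := by
    rw [← LinearMap.ker_eq_bot, LinearMap.ker_eq_bot']
    intro w hw
    by_contra h0
    exact (hcon w h0).2 hw
  have h1 : (A * Bᵀ).rank = Bᵀ.rank := by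
    rw [Matrix.rank, Matrix.mulVecLin_mul, LinearMap.range_comp]
    exact (Submodule.equivMapOfInjective _ hA _).finrank_eq.symm
  have h2 : B.rank = r := by
    rw [Matrix.rank, LinearMap.finrank_range_of_inj hB]
    simp
  rw [h1, Matrix.rank_transpose, h2] at h
  exact lt_irrefl _ h

theorem hess_zero {E : Type*} [NormedAddCommGroup E] [NormedSpace ℝ E] (f : E → ℝ) (x : E) :
    hess f x 0 = 0 := by
  simp [hess]

theorem eq_zero_of_forall_mul_add_nonneg {x c : ℝ} (h : ∀ t : ℝ, 0 ≤ c + t * x) : x = 0 := by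
  by_contra hx
  have := h (-(c + 1) / x)
  rw [div_mul_cancel₀ _ hx] at this
  linarith

/-- At a rank-deficient second-order stationary point the gradient has operator norm at
most `lam`. -/
theorem IsSOSP.opBound_of_rank_lt (h : IsSOSP (loraLoss f lam) (A, B))
    (hf : TwiceDifferentiable f) (hG : ∀ U, dirDeriv f (A * Bᵀ) U = frob G U) (hlam : 0 ≤ lam)
    (hr : (A * Bᵀ).rank < r) : OpBound (-G) lam := by
  obtain ⟨w, hw, hw0⟩ := exists_mulVec_eq_zero_of_rank_lt hr
  have hww : 0 < w ⬝ᵥ w := (dot_self_nonneg w).lt_of_ne' fun h => hw (dotProduct_self_eq_zero.1 h)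
  intro u v
  rw [neg_mulVec, dotProduct_neg]
  rcases hlam.eq_or_lt with rfl | hlam
  -- Without balancedness only one factor need kill `w`. Scaling the block it multiplies by `t`
  -- leaves the Hessian term fixed while the gradient term is linear in `t`, hence zero.
  · have : (u ⬝ᵥ G *ᵥ v) = 0 := by
      rcases hw0 with hw0 | hw0
      · have := eq_zero_of_forall_mul_add_nonneg
          (x := 2 * ((w ⬝ᵥ w) * (u ⬝ᵥ G *ᵥ v))) fun t => by
            have := h.second_order hf hG u v w (t • w)
            rw [mulVec_smul, hw0, dotProduct_smul, smul_zero, zero_vecMulVec, smul_eq_mul,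
              zero_mul, add_zero] at this
            exact this.trans_eq (by ring)
        simpa [hww.ne'] using this
      · have := eq_zero_of_forall_mul_add_nonneg
          (x := 2 * ((w ⬝ᵥ w) * (u ⬝ᵥ G *ᵥ v))) fun t => by
            have := h.second_order hf hG u v (t • w) w
            rw [mulVec_smul, hw0, smul_dotProduct, smul_zero, vecMulVec_zero_right, smul_eq_mul,
              zero_mul, add_zero] at this
            exact this.trans_eq (by ring)
        simpa [hww.ne'] using this
    simp [this]
  -- Balanced factors have the same kernel, so along `w` the Hessian of `f` drops out.
  · have hbal := balanced_of_grad hlam (h.grad_mul_right hf hG) (h.grad_mul_left hf hG)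
    have hAB : (A *ᵥ w) ⬝ᵥ (A *ᵥ w) = (B *ᵥ w) ⬝ᵥ (B *ᵥ w) := by
      rw [dotProduct_mulVec, ← mulVec_transpose, mulVec_mulVec, hbal, dotProduct_mulVec (B *ᵥ w),
        ← mulVec_transpose, mulVec_mulVec]
    have hA : A *ᵥ w = 0 := by
      rcases hw0 with hw0 | hw0
      · exact hw0
      · rw [hw0, dotProduct_zero] at hAB
        exact dotProduct_self_eq_zero.1 hAB
    have hB : B *ᵥ w = 0 := by
      rw [hA, dotProduct_zero] at hAB
      exact dotProduct_self_eq_zero.1 hAB.symm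
    have := h.second_order hf hG u v w w
    rw [hA, hB, vecMulVec_zero_right, zero_vecMulVec, add_zero, hess_zero] at this
    have h3 : 0 ≤ (w ⬝ᵥ w) * (2 * (u ⬝ᵥ G *ᵥ v) + lam * (u ⬝ᵥ u + v ⬝ᵥ v)) := by linarith
    have := nonneg_of_mul_nonneg_right h3 hww
    linarith

end stationary

/-! ### Positivity of the radius and comparison of the constants -/

section constants

variable {m n r : ℕ} {f : Matrix (Fin m) (Fin n) ℝ → ℝ} {Xs : Matrix (Fin m) (Fin n) ℝ}
  {D α β : ℝ}

/-- For `D ≤ 0` at most `X = Xs` is tested, so every constant is admissible and none is largest. -/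
theorem IsRSCConstant.radius_pos (h : IsRSCConstant f r D Xs α) : 0 < D := by
  by_contra! hD
  have := h.2 (show α + 1 ∈ _ from fun X hX _ => by
    have h0 : X - Xs = 0 := norm_le_zero_iff.1 (hX.trans hD)
    simp [h0, dirDeriv])
  linarith

/-- The smoothness constant dominates the strong convexity constant. -/
theorem RestrictedStronglyConvex.le_of_restrictedSmooth (hf : TwiceDifferentiable f) (hD : 0 < D)
    (h0 : 1 ≤ Xs.rank) (hr : Xs.rank ≤ r) (hα : RestrictedStronglyConvex f r D Xs α)
    (hβ : RestrictedSmooth f r D Xs β) : α ≤ β := by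
  obtain ⟨p, q, hp, hq, hX⟩ := exists_svd Xs
  have hs : ∀ i : Fin Xs.rank, 0 < sigma Xs (i + 1) := fun i => (sigma_succ_pos_iff Xs i).2 i.2
  set s : Fin Xs.rank → ℝ := fun i => sigma Xs (i + 1) with hsdef
  let i : Fin Xs.rank := ⟨0, h0⟩
  have hXv : Xs *ᵥ q i = s i • p i := by
    conv_lhs => rw [hX]
    rw [sum_mulVec]
    simp [smul_mulVec, vecMulVec_mulVec, hq _ i, s]
  have hvX : p i ᵥ* Xs = s i • q i := by
    conv_lhs => rw [hX]
    rw [vecMul_sum]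
    simp [vecMul_smul, vecMul_vecMulVec, hp i, s]
  have hpi : p i ⬝ᵥ p i = 1 := by simp [hp i i]
  have hqi : q i ⬝ᵥ q i = 1 := by simp [hq i i]
  have hUX : vecMulVec (p i) (p i) * Xs = s i • vecMulVec (p i) (q i) := by
    rw [vecMulVec_mul, hvX, vecMulVec_smul]
  have hXV : Xs * vecMulVec (q i) (q i) = s i • vecMulVec (p i) (q i) := by
    rw [mul_vecMulVec, hXv, smul_vecMulVec]
  set Δ := vecMulVec (p i) (p i) * Xs + Xs * vecMulVec (q i) (q i) with hΔ
  -- As a left multiple of `Xs`, `Δ` keeps `Xs + t Δ` within the rank constraint, so both constants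
  -- apply to the same direction.
  have hΔ2 : Δ = (2 : ℝ) • vecMulVec (p i) (p i) * Xs := by
    rw [hΔ, hXV, ← hUX, Matrix.smul_mul, two_smul]
  have hΔ0 : 0 < ‖Δ‖ := by
    rw [hΔ, hUX, hXV, ← two_smul ℝ, norm_smul, norm_smul, norm_vecMulVec_eq_one hpi hqi]
    have := (hs i).ne'
    simp only [mul_one]
    rw [mul_pos_iff_of_pos_left (by norm_num), norm_pos_iff]
    exact this
  have h1 : α * ‖Δ‖ ^ 2 ≤ hess f Xs Δ := by
    refine mul_norm_sq_le_hess hf.2 (ε := D / ‖Δ‖) (by positivity) fun t ht0 ht => ?_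
    have := hα (Xs + t • Δ) ?_ ?_
    · simpa using this
    · rw [add_sub_cancel_left, norm_smul, Real.norm_eq_abs, abs_of_pos ht0]
      exact ((lt_div_iff₀ hΔ0).1 ht).le
    · have : Xs + t • Δ = (1 + t • (2 : ℝ) • vecMulVec (p i) (p i)) * Xs := by
        rw [hΔ2, Matrix.add_mul, Matrix.one_mul, Matrix.smul_mul t]
      rw [this]
      exact (Matrix.rank_mul_le_right _ _).trans hr
  have h2 := hβ Xs (by simpa using hD.le) hr _ _
    (rank_vecMulVec_eq_one (ne_zero_of_dot_self_eq_one hpi) (ne_zero_of_dot_self_eq_one hpi))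
    (norm_vecMulVec_eq_one hpi hpi)
    (rank_vecMulVec_eq_one (ne_zero_of_dot_self_eq_one hqi) (ne_zero_of_dot_self_eq_one hqi))
    (norm_vecMulVec_eq_one hqi hqi)
  exact le_of_mul_le_mul_right (h1.trans h2) (by positivity)

end constants

/-! ### Gradient splitting and the two key inequalities -/

section main

variable {m n r k : ℕ}

theorem exists_svd_of_rank_eq {X : Matrix (Fin m) (Fin n) ℝ} (hk : X.rank = k) :
    ∃ (p : Fin k → Fin m → ℝ) (q : Fin k → Fin n → ℝ), Ortho p ∧ Ortho q ∧
      X = ∑ i : Fin k, sigma X (i + 1) • vecMulVec (p i) (q i) := by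
  subst hk
  exact exists_svd X

section pairs

variable {p : Fin k → Fin m → ℝ} {q : Fin k → Fin n → ℝ} {s : Fin k → ℝ}
  {X : Matrix (Fin m) (Fin n) ℝ}

theorem mulVec_right_singular (hq : Ortho q) (hX : X = ∑ i, s i • vecMulVec (p i) (q i))
    (i : Fin k) : X *ᵥ q i = s i • p i := by
  rw [hX, sum_mulVec]
  simp [smul_mulVec, vecMulVec_mulVec, hq _ i]

theorem transpose_mulVec_left_singular (hp : Ortho p)
    (hX : X = ∑ i, s i • vecMulVec (p i) (q i)) (i : Fin k) : Xᵀ *ᵥ p i = s i • q i := by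
  rw [mulVec_transpose, hX, vecMul_sum]
  simp [vecMul_smul, vecMul_vecMulVec, hp i]

/-- Splitting off the singular directions of a matrix `-G` that acts as multiplication by `lam`
on the pairs `(p i, q i)` and has operator norm at most `c` on their complement. -/
theorem exists_opBound_split (hp : Ortho p) (hq : Ortho q) {lam c : ℝ} (hlam : 0 ≤ lam)
    (hc : 0 < c) {G : Matrix (Fin m) (Fin n) ℝ} (hGq : ∀ i, G *ᵥ q i = -(lam • p i))
    (hGp : ∀ i, Gᵀ *ᵥ p i = -(lam • q i))
    (hG : ∀ u v, (∀ i, p i ⬝ᵥ u = 0) → (∀ i, q i ⬝ᵥ v = 0) →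
      2 * (u ⬝ᵥ (-G) *ᵥ v) ≤ c * (u ⬝ᵥ u + v ⬝ᵥ v)) :
    ∃ Z W : Matrix (Fin m) (Fin n) ℝ, OpBound Z lam ∧ OpBound W 1 ∧ (∀ i, W *ᵥ q i = 0) ∧
      (∀ i v, p i ⬝ᵥ W *ᵥ v = 0) ∧ -G = Z + (c - lam) • W := by
  set P : Matrix (Fin m) (Fin n) ℝ := ∑ i, vecMulVec (p i) (q i) with hP
  have hPv : ∀ v, P *ᵥ v = ∑ i, (q i ⬝ᵥ v) • p i := by
    intro v
    rw [hP, sum_mulVec]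
    simp [vecMulVec_mulVec]
  have hPq : ∀ i, P *ᵥ q i = p i := by
    intro i
    rw [hPv]
    simp [hq _ i]
  set H : Matrix (Fin m) (Fin n) ℝ := -G - lam • P with hH
  have hHq : ∀ i, H *ᵥ q i = 0 := by
    intro i
    rw [hH, sub_mulVec, neg_mulVec, smul_mulVec, hGq, hPq]
    simp
  have hHp : ∀ i v, p i ⬝ᵥ H *ᵥ v = 0 := by
    intro i v
    rw [hH, sub_mulVec, neg_mulVec, smul_mulVec, dotProduct_sub, dotProduct_neg, dotProduct_smul,
      hPv, hp.dot_sum, dotProduct_mulVec, ← mulVec_transpose, hGp]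
    simp
  have hHb : ∀ u v, 2 * (u ⬝ᵥ H *ᵥ v) ≤
      c * ((u ⬝ᵥ u - ∑ i, (p i ⬝ᵥ u) ^ 2) + (v ⬝ᵥ v - ∑ i, (q i ⬝ᵥ v) ^ 2)) := by
    intro u v
    set u' := u - ∑ i, (p i ⬝ᵥ u) • p i with hu'
    set v' := v - ∑ i, (q i ⬝ᵥ v) • q i with hv'
    have e1 : u ⬝ᵥ H *ᵥ v = u' ⬝ᵥ H *ᵥ v := by
      rw [hu', sub_dotProduct, sum_dotProduct]
      simp [smul_dotProduct, hHp]
    have e2 : H *ᵥ v = H *ᵥ v' := by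
      rw [hv', mulVec_sub, mulVec_sum]
      simp [mulVec_smul, hHq]
    have e3 : H *ᵥ v' = (-G) *ᵥ v' := by
      rw [hH, sub_mulVec, smul_mulVec, hPv]
      simp [hv', hq.dot_residual]
    rw [e1, e2, e3, ← hp.residual_sq, ← hq.residual_sq]
    exact hG u' v' (hp.dot_residual u) (hq.dot_residual v)
  -- `H` is `-G` with its singular part `lam P` removed and has norm at most `c`; the share `lam /
  -- c` of `H` fits in `Z`, the rest is `(c - lam) W`.
  refine ⟨lam • P + (lam / c) • H, c⁻¹ • H, ?_, ?_, ?_, ?_, ?_⟩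
  · intro u v
    have h1 : 2 * (u ⬝ᵥ P *ᵥ v) ≤ ∑ i, (p i ⬝ᵥ u) ^ 2 + ∑ i, (q i ⬝ᵥ v) ^ 2 := by
      rw [hPv, dotProduct_sum, mul_sum, ← sum_add_distrib]
      refine sum_le_sum fun i _ => ?_
      rw [dotProduct_smul, dotProduct_comm u, smul_eq_mul]
      nlinarith [sq_nonneg (p i ⬝ᵥ u - q i ⬝ᵥ v)]
    have h2 := mul_le_mul_of_nonneg_left h1 hlam
    have h3 := mul_le_mul_of_nonneg_left (hHb u v) (div_nonneg hlam hc.le)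
    rw [← mul_assoc (lam / c) c, div_mul_cancel₀ _ hc.ne'] at h3
    rw [add_mulVec, smul_mulVec, smul_mulVec, dotProduct_add, dotProduct_smul, dotProduct_smul,
      smul_eq_mul, smul_eq_mul]
    linarith
  · intro u v
    have h1 := mul_le_mul_of_nonneg_left (hHb u v) (inv_nonneg.2 hc.le)
    rw [inv_mul_cancel_left₀ hc.ne'] at h1
    rw [smul_mulVec, dotProduct_smul, smul_eq_mul]
    have h2 : 0 ≤ ∑ i, (p i ⬝ᵥ u) ^ 2 := by positivity
    have h3 : 0 ≤ ∑ i, (q i ⬝ᵥ v) ^ 2 := by positivity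
    linarith
  · intro i
    rw [smul_mulVec, hHq, smul_zero]
  · intro i v
    rw [smul_mulVec, dotProduct_smul, hHp, smul_zero]
  · have : lam / c + (c - lam) * c⁻¹ = 1 := by field_simp; ring
    rw [add_assoc, smul_smul, ← add_smul, this, one_smul, hH]
    abel

end pairs

variable {f : Matrix (Fin m) (Fin n) ℝ → ℝ} {lam : ℝ} {A : Matrix (Fin m) (Fin r) ℝ}
  {B : Matrix (Fin n) (Fin r) ℝ} {G Xs : Matrix (Fin m) (Fin n) ℝ}

theorem rank_mul_transpose_le (A : Matrix (Fin m) (Fin r) ℝ) (B : Matrix (Fin n) (Fin r) ℝ) :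
    (A * Bᵀ).rank ≤ r := by
  simpa using (Matrix.rank_mul_le_left A Bᵀ).trans A.rank_le_width

theorem IsSOSP.frob_grad_self (h : IsSOSP (loraLoss f lam) (A, B)) (hf : TwiceDifferentiable f)
    (hG : ∀ U, dirDeriv f (A * Bᵀ) U = frob G U) (hlam : 0 ≤ lam) :
    frob G (A * Bᵀ) = -(lam * nuclearNorm (A * Bᵀ)) := by
  obtain ⟨p, q, hp, hq, hX⟩ := exists_svd (A * Bᵀ)
  have h1 := h.grad_mul_right hf hG
  have h2 := h.grad_mul_left hf hG
  refine (congrArg (frob G) hX).trans ?_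
  rw [frob_sum_right, nuclearNorm_eq_sum, mul_sum, ← sum_neg_distrib]
  refine sum_congr rfl fun i _ => ?_
  have h3 := (grad_mulVec_singular hlam h1 h2 ((sigma_succ_pos_iff (A * Bᵀ) i).2 i.2)
    (mulVec_right_singular hq hX i) (transpose_mulVec_left_singular hp hX i)).1
  rw [frob_smul_right, frob_vecMulVec_right, h3, dotProduct_neg, dotProduct_smul, hp]
  simp [mul_comm]

/-- The terms `± lam ‖X‖_*` from `⟨G, X⟩` and from the bound on `⟨-∇f(Xs), X⟩` cancel. -/
theorem mul_norm_sub_sq_le (h : IsSOSP (loraLoss f lam) (A, B)) (hf : TwiceDifferentiable f)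
    (hG : ∀ U, dirDeriv f (A * Bᵀ) U = frob G U) (hlam : 0 ≤ lam)
    (hXs : IsGlobalMin (fullLoss f lam) Xs) {D α : ℝ} (hα : RestrictedStronglyConvex f r D Xs α)
    (hD : ‖A * Bᵀ - Xs‖ ≤ D) :
    α * ‖A * Bᵀ - Xs‖ ^ 2 ≤ frob (-G) Xs - lam * nuclearNorm Xs := by
  obtain ⟨Gs, hGs⟩ := exists_dirDeriv_eq_frob f Xs
  have h1 := hα _ hD (rank_mul_transpose_le A B)
  rw [hG, hGs, frob_sub_right, frob_sub_right, h.frob_grad_self hf hG hlam] at h1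
  have h2 := (opBound_neg_of_isGlobalMin hf.1 hlam hXs hGs).frob_le (A * Bᵀ)
  have h3 := frob_le_of_isGlobalMin hf.1 hlam hXs hGs
  rw [frob_neg_left] at h2 ⊢
  linarith

theorem eq_of_opBound (h : IsSOSP (loraLoss f lam) (A, B)) (hf : TwiceDifferentiable f)
    (hG : ∀ U, dirDeriv f (A * Bᵀ) U = frob G U) (hlam : 0 ≤ lam)
    (hXs : IsGlobalMin (fullLoss f lam) Xs) {D α : ℝ} (hα : RestrictedStronglyConvex f r D Xs α)
    (hα0 : 0 < α) (hD : ‖A * Bᵀ - Xs‖ ≤ D) (hGb : OpBound (-G) lam) : A * Bᵀ = Xs := by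
  have h1 := mul_norm_sub_sq_le h hf hG hlam hXs hα hD
  have h2 := hGb.frob_le Xs
  have h3 : ‖A * Bᵀ - Xs‖ ^ 2 ≤ 0 := by
    by_contra! h0
    have := mul_pos hα0 h0
    linarith
  exact sub_eq_zero.1 (norm_eq_zero.1 (pow_eq_zero_iff two_ne_zero |>.1
    (le_antisymm h3 (sq_nonneg _))))

theorem sum_fin_ite_eq_sum_Icc (g : ℕ → ℝ) (l r : ℕ) :
    ∑ i : Fin r, (if l < i then g (i + 1) else 0) = ∑ s ∈ Icc (l + 1 + 1) r, g s := by
  rw [Fin.sum_univ_eq_sum_range (fun i => if l < i then g (i + 1) else 0), ← sum_filter,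
    ← Finset.Ico_add_one_right_eq_Icc, ← Finset.sum_Ico_add' g (l + 1) r 1]
  refine sum_congr ?_ fun _ _ => rfl
  ext x
  simp only [mem_filter, mem_range, mem_Ico]
  omega

/-- At a second-order stationary point of full rank `r`, the gradient excess over `lam` is
carried by a matrix `W` of operator norm at most one orthogonal to the singular vectors. -/
theorem exists_bounds_of_rank_eq (h : IsSOSP (loraLoss f lam) (A, B))
    (hf : TwiceDifferentiable f) (hlam : 0 ≤ lam) (hXs : IsGlobalMin (fullLoss f lam) Xs)
    {D α β : ℝ} (hα : RestrictedStronglyConvex f r D Xs α) (hβ : RestrictedSmooth f r D Xs β)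
    (hβ0 : 0 < β) (hD : ‖A * Bᵀ - Xs‖ ≤ D) (hrank : (A * Bᵀ).rank = r) (hXs0 : 1 ≤ Xs.rank)
    (hr : Xs.rank < r) :
    ∃ ν : ℝ, α * ‖A * Bᵀ - Xs‖ ^ 2 ≤ β * sigma (A * Bᵀ) r * ν ∧
      2 * sigma (A * Bᵀ) Xs.rank * ν + ∑ s ∈ Icc (Xs.rank + 1) r, sigma (A * Bᵀ) s ^ 2 ≤
        ‖A * Bᵀ - Xs‖ ^ 2 := by
  obtain ⟨G, hG⟩ := exists_dirDeriv_eq_frob f (A * Bᵀ)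
  obtain ⟨p, q, hp, hq, hX⟩ := exists_svd_of_rank_eq hrank
  have h1 := h.grad_mul_right hf hG
  have h2 := h.grad_mul_left hf hG
  have hs : ∀ i : Fin r, 0 < sigma (A * Bᵀ) (i + 1) := fun i =>
    (sigma_succ_pos_iff _ _).2 (by rw [hrank]; exact i.2)
  have hXq := mulVec_right_singular hq hX
  have hXp := transpose_mulVec_left_singular hp hX
  have hg := fun i => grad_mulVec_singular hlam h1 h2 (hs i) (hXq i) (hXp i)
  -- Zero-based index of `σ_r`; the smallest singular value gives the best bound `lam + β s`.
  let i₀ : Fin r := ⟨r - 1, by omega⟩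
  have hi₀ : (i₀ : ℕ) + 1 = r := by simp only [i₀]; omega
  have hσ : 0 < sigma (A * Bᵀ) r := by
    have := hs i₀
    rwa [hi₀] at this
  have hc : 0 < lam + β * sigma (A * Bᵀ) r := by positivity
  obtain ⟨Z, W, hZ, hW, hWq, hWp, hGZ⟩ := exists_opBound_split hp hq hlam hc
    (fun i => (hg i).1) (fun i => (hg i).2) fun u v hu hv =>
      two_mul_dot_le_of_unit hc.le (p := p i₀) (q := q i₀) (fun u v hu1 hv1 hpu _ => by
        have := h.neg_grad_le hf hG hlam hβ hD hrank.le (hs i₀) (by simp [hp i₀ i₀])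
          (by simp [hq i₀ i₀]) (hXq i₀) (hXp i₀) hu1 hv1 hpu
        rwa [hi₀, ← dotProduct_neg, ← neg_mulVec] at this) u v (hu i₀) (hv i₀)
  refine ⟨frob W Xs, ?_, ?_⟩
  · have h3 := mul_norm_sub_sq_le h hf hG hlam hXs hα hD
    have h4 := hZ.frob_le Xs
    rw [hGZ, frob_add_left, frob_smul_left, add_sub_cancel_left] at h3
    linarith
  -- Zero-based entry `l` of the spectrum is `σ_{rs}`; the singular values of `Xs` are absorbed into
  -- the left vectors.
  · obtain ⟨l, hl⟩ : ∃ l, Xs.rank = l + 1 := ⟨Xs.rank - 1, by omega⟩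
    obtain ⟨a, e, _, he, hY⟩ := exists_svd_of_rank_eq hl
    have := frob_add_tail_le hp hq (fun i => sigma (A * Bᵀ) (i + 1))
      (fun i j hij => sigma_antitone _ (Nat.add_le_add_right hij 1)) (fun i => sigma_nonneg _ _) l
      (by omega) he (fun j => sigma Xs (j + 1) • a j) hW hWq hWp (A * Bᵀ) Xs hX
      (by simpa only [smul_vecMulVec] using hY)
    rw [sum_fin_ite_eq_sum_Icc (fun s => sigma (A * Bᵀ) s ^ 2)] at this
    rwa [hl]

end main

end LoRA

/-! ### The two cases `rank X < r` and `rank X = r` -/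

theorem corollary1 {m n r rs K N : ℕ} {𝓧 𝓨 : Type*}
    (net : Matrix (Fin m) (Fin n) ℝ → 𝓧 → (Fin K → ℝ)) (ℓ : (Fin K → ℝ) → 𝓨 → ℝ)
    (W₀ : Matrix (Fin m) (Fin n) ℝ) (data : Fin N → 𝓧 × 𝓨)
    (f : Matrix (Fin m) (Fin n) ℝ → ℝ) (hf : f = LoRA.fullRisk net ℓ W₀ data)
    (hdiff : LoRA.TwiceDifferentiable f)
    (lam : ℝ) (hlam : 0 ≤ lam)
    (Xs : Matrix (Fin m) (Fin n) ℝ) (hXs : LoRA.IsGlobalMin (LoRA.fullLoss f lam) Xs)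
    (hrank : Xs.rank = rs) (hrs : 1 ≤ rs) (hr : rs < r)
    (D α β : ℝ) (hα : LoRA.IsRSCConstant f r D Xs α) (hβ : LoRA.IsRSMConstant f r D Xs β)
    (hα_pos : 0 < α)
    (A : Matrix (Fin m) (Fin r) ℝ) (B : Matrix (Fin n) (Fin r) ℝ)
    (hSOSP : LoRA.IsSOSP (LoRA.loraLoss f lam) (A, B))
    (X : Matrix (Fin m) (Fin n) ℝ) (hX : X = A * Bᵀ) (hD : ‖X - Xs‖ ≤ D) :
    (LoRA.sigma X r ≤ 2 * α / β * LoRA.sigma X rs →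
      LoRA.IsGlobalMin (LoRA.fullLoss f lam) X) ∧
    (2 * α / β * LoRA.sigma X rs < LoRA.sigma X r →
      ¬ LoRA.IsGlobalMin (LoRA.fullLoss f lam) X ∧
      Real.sqrt ((∑ s ∈ Finset.Icc (rs + 1) r, LoRA.sigma X s ^ 2) /
          (1 - 2 * α * LoRA.sigma X rs / (β * LoRA.sigma X r))) - ‖Xs‖ ≤ ‖X‖) := by
  subst hrank hX
  have hαβ : α ≤ β := LoRA.RestrictedStronglyConvex.le_of_restrictedSmooth hdiff hα.radius_pos hrs
    hr.le hα.1 hβ.1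
  have hβ0 : 0 < β := hα_pos.trans_le hαβ
  obtain ⟨G, hG⟩ := LoRA.exists_dirDeriv_eq_frob f (A * Bᵀ)
  have hτ := LoRA.sigma_nonneg (A * Bᵀ) Xs.rank
  rcases (LoRA.rank_mul_transpose_le A B).lt_or_eq with hlt | heq
  · have hXX := LoRA.eq_of_opBound hSOSP hdiff hG hlam hXs hα.1 hα_pos hD
      (hSOSP.opBound_of_rank_lt hdiff hG hlam hlt)
    have h0 : LoRA.sigma (A * Bᵀ) r = 0 := by
      have := LoRA.sigma_succ_eq_zero (A * Bᵀ) (i := r - 1) (by omega)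
      rwa [Nat.sub_add_cancel (by omega)] at this
    refine ⟨fun _ => hXX ▸ hXs, fun h => absurd h (not_lt.2 ?_)⟩
    rw [h0]
    positivity
  · obtain ⟨ν, h1, h2⟩ := LoRA.exists_bounds_of_rank_eq hSOSP hdiff hlam hXs hα.1 hβ.1 hβ0 hD heq
      hrs hr
    have hσ : 0 < LoRA.sigma (A * Bᵀ) r := by
      have := (LoRA.sigma_succ_pos_iff (A * Bᵀ) (r - 1)).2 (by omega)
      rwa [Nat.sub_add_cancel (by omega)] at this
    have hsum : LoRA.sigma (A * Bᵀ) r ^ 2 ≤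
        ∑ s ∈ Finset.Icc (Xs.rank + 1) r, LoRA.sigma (A * Bᵀ) s ^ 2 :=
      Finset.single_le_sum (f := fun s => LoRA.sigma (A * Bᵀ) s ^ 2) (fun _ _ => sq_nonneg _)
        (Finset.mem_Icc.2 ⟨hr, le_rfl⟩)
    have hβσ : 0 < β * LoRA.sigma (A * Bᵀ) r := mul_pos hβ0 hσ
    set σr := LoRA.sigma (A * Bᵀ) r
    set σs := LoRA.sigma (A * Bᵀ) Xs.rank
    set τ := ∑ s ∈ Finset.Icc (Xs.rank + 1) r, LoRA.sigma (A * Bᵀ) s ^ 2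
    have hτ0 : 0 < τ := (pow_pos hσ 2).trans_le hsum
    refine ⟨fun h => ?_, fun h => ⟨fun hmin => ?_, ?_⟩⟩
    -- Full rank is impossible here: `α ‖X - Xs‖² ≤ β σ_r ν ≤ 2 α σ_{rs} ν ≤ α (‖X - Xs‖² - τ)` with
    -- `τ > 0`.
    · rw [div_mul_eq_mul_div, le_div_iff₀ hβ0] at h
      have hν : 0 ≤ ν := by
        have : 0 ≤ β * σr * ν := le_trans (by positivity) h1
        exact nonneg_of_mul_nonneg_right this hβσ
      have h3 := mul_le_mul_of_nonneg_left h2 hα_pos.le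
      have h4 := mul_le_mul_of_nonneg_right h hν
      have h5 := mul_pos hα_pos hτ0
      nlinarith
    -- A global minimizer would satisfy the operator bound and equal `Xs`, whose rank is below `r`.
    · have := LoRA.eq_of_opBound hSOSP hdiff hG hlam hXs hα.1 hα_pos hD
        (LoRA.opBound_neg_of_isGlobalMin hdiff.1 hlam hmin hG)
      rw [this] at heq
      omega
    · rw [div_mul_eq_mul_div, div_lt_iff₀ hβ0] at h
      have hden : 0 < 1 - 2 * α * σs / (β * σr) := by
        rw [sub_pos, div_lt_one hβσ]
        linarith
      have h3 : τ / (1 - 2 * α * σs / (β * σr)) ≤ ‖A * Bᵀ - Xs‖ ^ 2 := by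
        rw [div_le_iff₀ hden]
        have h4 : 2 * α * σs / (β * σr) * ‖A * Bᵀ - Xs‖ ^ 2 ≤ 2 * σs * ν := by
          rw [div_mul_eq_mul_div, div_le_iff₀ hβσ]
          have := mul_le_mul_of_nonneg_left h1 (mul_nonneg zero_le_two hτ)
          linarith
        linarith
      have h4 := Real.sqrt_le_sqrt h3
      rw [Real.sqrt_sq (norm_nonneg _)] at h4
      have h5 := norm_sub_le (A * Bᵀ) Xs
      linarith
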